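/- Let $d\ge 0$ be an integer, let $E_0,E_1,E_2$ be complex Banach spaces and let $\bullet:E_0\times E_1\to E_2$ be a multiplication, i.e. a continuous bilinear map with $|x\bullet y|_{E_2}\le |x|_{E_0}|y|_{E_1}$. Write $\mathcal S'(\mathbb R^d,E)$ for the continuous linear maps $\mathcal S(\mathbb R^d)\to E$ and $\langle x\rangle=(1+|x|^2)^{1/2}$. For a window $g\in\mathcal S(\mathbb R^d)\setminus\{0\}$ and $f\in\mathcal S'(\mathbb R^d,E)$ let $V_gf(x,\xi)=\langle f, e^{2\pi i \xi\cdot}g(\cdot-x)\rangle$ be the short-time Fourier transform (the bracket being conjugate-linear in the second entry). For $1\le p,q\le\infty$ and $r,s\in\mathbb R$ put $$\|f\|_{M^{p,q}_{r,s}}=\Big(\int\Big(\int |V_gf(x,\xi)|_E^p\langle x\rangle^{rp}dx\Big)^{q/p}\langle\xi\rangle^{sq}d\xi\Big)^{1/q},\qquad \|f\|_{W^{p,q}_{r,s}}=\Big(\int\Big(\int |V_gf(x,\xi)|_E^p\langle \xi\rangle^{rp}d\xi\Big)^{q/p}\langle x\rangle^{sq}dx\Big)^{1/q},$$ with the usual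 modification if $p$ or $q$ is $\infty$, and let $M^{p,q}_{r,s}(\mathbb R^d,E)$ and $W^{p,q}_{r,s}(\mathbb R^d,E)$ be the spaces of $f\in\mathcal S'(\mathbb R^d,E)$ for which the respective norm is finite for some window $g\ne0$. For $u\in\mathcal S'(\mathbb R^d,E_0)$ and $v\in\mathcal S'(\mathbb R^d,E_1)$, the product $u\bullet v\in\mathcal S'(\mathbb R^d,E_2)$ is said to exist, and to be equal to $w$, if for all $\rho,\sigma\in\mathcal S(\mathbb R^d)$ with $\int\rho=\int\sigma=1$ one has $(u*\rho_\varepsilon)\bullet(v*\sigma_\varepsilon)\to w$ in the sense of tempered distributions (tested against each Schwartz function) as $\varepsilon\to0^+$, where $\rho_\varepsilon=\varepsilon^{-d}\rho(\cdot/\varepsilon)$ and likewise $\sigma_\varepsilon$. With $\mathcal Ff(\xi)=\int e^{-2\pi i x\cdot\xi}f(x)\,dx$, the Fourier multiplier with symbol $\mu\in\mathcal S'(\mathbb R^d,E_0)$ is the linear map $\mu(D)f=\mathcal F^{-1}(\mu\bullet\mathcal Ff)$, whose domain consists of all $f\in\mathcal S'(\mathbb R^d,E_1)$ for which the product $\mu\bullet\mathcal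 F f$ exists. **Proposition.** Let $1\le p,q\le\infty$ and $r,s,\delta\in\mathbb R$, and let nonzero windows $g_0,g_1,g_2$ be fixed, used for the norms of $\mu$, $f$ and $\mu(D)f$ respectively. There is a constant $C>0$ such that for every $\mu\in M^{\infty,1}_{\delta,|s|}(\mathbb R^d,E_0)$ the space $W^{p,q}_{r,s}(\mathbb R^d,E_1)$ is contained in the domain of $\mu(D)$, and for every $f\in W^{p,q}_{r,s}(\mathbb R^d,E_1)$ one has $\mu(D)f\in W^{p,q}_{r+\delta,s}(\mathbb R^d,E_2)$ and $$\|\mu(D)f\|_{W^{p,q}_{r+\delta,s}}\le C\,\|\mu\|_{M^{\infty,1}_{\delta,|s|}}\,\|f\|_{W^{p,q}_{r,s}}.$$ -/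

import Mathlib

open MeasureTheory Filter Topology SchwartzMap FourierTransform
open scoped ENNReal

noncomputable section

/-- The Euclidean space `ℝᵈ`. -/
abbrev Rd (d : ℕ) : Type := EuclideanSpace ℝ (Fin d)

/-! ### Test functions -/

section TestFunctions

variable {d : ℕ}

/-- The function `y ↦ exp (-2πi y·ξ)`. -/
def negCharacter (ξ : Rd d) (y : Rd d) : ℂ :=
  Complex.exp (((-(2 * Real.pi * inner ℝ y ξ) : ℝ) : ℂ) * Complex.I)

theorem hasTemperateGrowth_exp_mul_I :
    Function.HasTemperateGrowth (fun t : ℝ => Complex.exp ((t : ℂ) * Complex.I)) := by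
  have hder : ∀ n : ℕ, iteratedDeriv n (fun t : ℝ => Complex.exp ((t : ℂ) * Complex.I))
      = fun t : ℝ => Complex.I ^ n * Complex.exp ((t : ℂ) * Complex.I) := by
    intro n
    induction n with
    | zero => simp
    | succ n ih =>
      rw [iteratedDeriv_succ, ih]
      funext t
      have h1 : HasDerivAt (fun t : ℝ => (t : ℂ) * Complex.I) (1 * Complex.I) t :=
        (Complex.ofRealCLM.hasDerivAt (x := t)).mul_const Complex.I
      have h2 := (h1.cexp).const_mul (Complex.I ^ n)
      rw [h2.deriv]
      ring
  refine ⟨?_, fun n => ⟨0, 1, fun t => ?_⟩⟩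
  · exact (Complex.ofRealCLM.contDiff.mul contDiff_const).cexp
  · rw [norm_iteratedFDeriv_eq_norm_iteratedDeriv, hder]
    simp [Complex.norm_exp_ofReal_mul_I]

theorem hasTemperateGrowth_negCharacter (ξ : Rd d) :
    Function.HasTemperateGrowth (negCharacter ξ) := by
  have h : Function.HasTemperateGrowth (fun y : Rd d => (-(2 * Real.pi * inner ℝ y ξ) : ℝ)) := by
    fun_prop
  exact hasTemperateGrowth_exp_mul_I.comp h

/-- The test function `y ↦ exp (-2πi y·ξ) * conj (g (y - x))`, the complex conjugate of the
time-frequency shift `M_ξ T_x g` of the window `g`. -/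
def conjTFShift (g : 𝓢(Rd d, ℂ)) (x ξ : Rd d) : 𝓢(Rd d, ℂ) :=
  smulLeftCLM ℂ (negCharacter ξ)
    (compSubConstCLM ℂ x (postcompCLM (𝕜 := ℝ) (Complex.conjCLE : ℂ →L[ℝ] ℂ) g))

theorem conjTFShift_apply (g : 𝓢(Rd d, ℂ)) (x ξ y : Rd d) :
    conjTFShift g x ξ y = negCharacter ξ y * (starRingEnd ℂ) (g (y - x)) := by
  simp [conjTFShift, smulLeftCLM_apply_apply (hasTemperateGrowth_negCharacter ξ)]

/-- The test function `y ↦ ε⁻ᵈ ρ (ε⁻¹ (x - y))` for `ε ≠ 0` (and `0` for `ε = 0`). -/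
def reflDilate (ρ : 𝓢(Rd d, ℂ)) (ε : ℝ) (x : Rd d) : 𝓢(Rd d, ℂ) :=
  if h : ε = 0 then 0 else
    ((ε ^ d)⁻¹ : ℝ) • compSubConstCLM ℂ x
      (compCLMOfContinuousLinearEquiv ℂ
        (ContinuousLinearEquiv.smulLeft (R₁ := ℝ) (Units.mk0 (-ε⁻¹) (by simpa using h))) ρ)

theorem reflDilate_apply (ρ : 𝓢(Rd d, ℂ)) {ε : ℝ} (h : ε ≠ 0) (x y : Rd d) :
    reflDilate ρ ε x y = (((ε ^ d)⁻¹ : ℝ) : ℂ) * ρ (ε⁻¹ • (x - y)) := by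
  have h1 : (-ε⁻¹) • (y - x) = ε⁻¹ • (x - y) := by
    rw [neg_smul, ← smul_neg, neg_sub]
  simp only [reflDilate, h, dite_false, _root_.smul_apply, compSubConstCLM_apply,
    compCLMOfContinuousLinearEquiv_apply, Function.comp_apply, Complex.real_smul]
  rw [← h1]
  rfl

end TestFunctions

/-! ### Time-frequency analysis of vector-valued tempered distributions

Tempered distributions are `ℂ`-linear maps on the Schwartz space here; the sesquilinear bracket
`⟨f, g⟩` of a distribution and a test function is therefore `f (conj g)`. -/

section TimeFrequency

variable {d : ℕ} {E : Type*} [NormedAddCommGroup E] [NormedSpace ℂ E]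

/-- The short-time Fourier transform `V_g f (x, ξ) = ⟨f, M_ξ T_x g⟩`. -/
def stft (g : 𝓢(Rd d, ℂ)) (f : 𝓢'(Rd d, E)) (x ξ : Rd d) : E :=
  f (conjTFShift g x ξ)

/-- The weight `⟨x⟩ ^ r = (1 + |x|²) ^ (r / 2)`. -/
def bracketPow (r : ℝ) (x : Rd d) : ℝ := (1 + ‖x‖ ^ 2) ^ (r / 2)

/-- The modulation space norm with window `g`, as an extended nonnegative number: the `L^q_s` norm
in `ξ` of the `L^p_r` norm in `x` of `V_g f (x, ξ)`. -/
def modulationNorm (p q : ℝ≥0∞) (r s : ℝ) (g : 𝓢(Rd d, ℂ)) (f : 𝓢'(Rd d, E)) : ℝ≥0∞ :=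
  eLpNorm (fun ξ : Rd d =>
    ENNReal.ofReal (bracketPow s ξ) *
      eLpNorm (fun x : Rd d => bracketPow r x * ‖stft g f x ξ‖) p volume) q volume

/-- The Wiener amalgam space norm with window `g`: the `L^q_s` norm in `x` of the `L^p_r` norm
in `ξ` of `V_g f (x, ξ)`. -/
def amalgamNorm (p q : ℝ≥0∞) (r s : ℝ) (g : 𝓢(Rd d, ℂ)) (f : 𝓢'(Rd d, E)) : ℝ≥0∞ :=
  eLpNorm (fun x : Rd d =>
    ENNReal.ofReal (bracketPow s x) *
      eLpNorm (fun ξ : Rd d => bracketPow r ξ * ‖stft g f x ξ‖) p volume) q volume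

/-- Membership in the modulation space `M^{p,q}_{r,s}(ℝᵈ, E)`. -/
def MemModulation (p q : ℝ≥0∞) (r s : ℝ) (f : 𝓢'(Rd d, E)) : Prop :=
  ∃ g : 𝓢(Rd d, ℂ), g ≠ 0 ∧ modulationNorm p q r s g f < ∞

/-- Membership in the Wiener amalgam space `W^{p,q}_{r,s}(ℝᵈ, E)`. -/
def MemAmalgam (p q : ℝ≥0∞) (r s : ℝ) (f : 𝓢'(Rd d, E)) : Prop :=
  ∃ g : 𝓢(Rd d, ℂ), g ≠ 0 ∧ amalgamNorm p q r s g f < ∞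

/-- The regularization `f * ρ_ε` with `ρ_ε = ε⁻ᵈ ρ(·/ε)`, as a function:
`(f * ρ_ε)(x) = f (ρ_ε (x - ·))`. -/
def regularize (f : 𝓢'(Rd d, E)) (ρ : 𝓢(Rd d, ℂ)) (ε : ℝ) (x : Rd d) : E :=
  f (reflDilate ρ ε x)

end TimeFrequency

/-! ### Products of distributions and Fourier multipliers -/

section Multipliers

variable {d : ℕ} {E₀ E₁ E₂ : Type*}
  [NormedAddCommGroup E₀] [NormedSpace ℂ E₀] [NormedAddCommGroup E₁] [NormedSpace ℂ E₁]
  [NormedAddCommGroup E₂] [NormedSpace ℂ E₂]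

/-- `w` is the product `u • v` of the tempered distributions `u` and `v` with respect to the
bilinear map `B`: for all Schwartz mollifiers `ρ`, `σ` with integral one, the pointwise products
`(u * ρ_ε) • (v * σ_ε)` of the regularizations converge to `w` in the sense of tempered
distributions as `ε → 0+`. -/
def IsDistribProduct (B : E₀ →L[ℂ] E₁ →L[ℂ] E₂)
    (u : 𝓢'(Rd d, E₀)) (v : 𝓢'(Rd d, E₁)) (w : 𝓢'(Rd d, E₂)) : Prop :=
  ∀ ρ σ : 𝓢(Rd d, ℂ), ∫ x, ρ x = 1 → ∫ x, σ x = 1 → ∀ φ : 𝓢(Rd d, ℂ),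
    (∀ᶠ ε in 𝓝[>] (0 : ℝ),
      Integrable (fun x => φ x • B (regularize u ρ ε x) (regularize v σ ε x))) ∧
    Tendsto (fun ε : ℝ => ∫ x, φ x • B (regularize u ρ ε x) (regularize v σ ε x))
      (𝓝[>] 0) (𝓝 (w φ))

theorem exists_mollifier (d : ℕ) : ∃ ρ : 𝓢(Rd d, ℂ), ∫ x, ρ x = 1 := by
  let b : ContDiffBump (0 : Rd d) := ⟨1, 2, one_pos, one_lt_two⟩
  have h1 : HasCompactSupport (Complex.ofRealCLM ∘ b.normed volume) :=
    b.hasCompactSupport_normed.comp_left rfl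
  have h2 : ContDiff ℝ (⊤ : ℕ∞) (Complex.ofRealCLM ∘ b.normed volume) :=
    Complex.ofRealCLM.contDiff.comp b.contDiff_normed
  refine ⟨h1.toSchwartzMap h2, ?_⟩
  have h3 : ∫ x, ((b.normed volume x : ℝ) : ℂ) = 1 := by
    rw [integral_complex_ofReal, b.integral_normed, Complex.ofReal_one]
  exact h3

theorem IsDistribProduct.unique {B : E₀ →L[ℂ] E₁ →L[ℂ] E₂}
    {u : 𝓢'(Rd d, E₀)} {v : 𝓢'(Rd d, E₁)} {w w' : 𝓢'(Rd d, E₂)}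
    (h : IsDistribProduct B u v w) (h' : IsDistribProduct B u v w') : w = w' := by
  obtain ⟨ρ, hρ⟩ := exists_mollifier d
  ext φ
  exact tendsto_nhds_unique (h ρ ρ hρ hρ φ).2 (h' ρ ρ hρ hρ φ).2

theorem IsDistribProduct.zero_right (B : E₀ →L[ℂ] E₁ →L[ℂ] E₂) (u : 𝓢'(Rd d, E₀)) :
    IsDistribProduct B u 0 0 := by
  intro ρ σ _ _ φ
  simp [regularize]

theorem IsDistribProduct.add_right {B : E₀ →L[ℂ] E₁ →L[ℂ] E₂}
    {u : 𝓢'(Rd d, E₀)} {v v' : 𝓢'(Rd d, E₁)} {w w' : 𝓢'(Rd d, E₂)}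
    (h : IsDistribProduct B u v w) (h' : IsDistribProduct B u v' w') :
    IsDistribProduct B u (v + v') (w + w') := by
  intro ρ σ hρ hσ φ
  obtain ⟨hi, ht⟩ := h ρ σ hρ hσ φ
  obtain ⟨hi', ht'⟩ := h' ρ σ hρ hσ φ
  have key : ∀ ε x, φ x • B (regularize u ρ ε x) (regularize (v + v') σ ε x)
      = φ x • B (regularize u ρ ε x) (regularize v σ ε x)
        + φ x • B (regularize u ρ ε x) (regularize v' σ ε x) := by
    intro ε x
    have : regularize (v + v') σ ε x = regularize v σ ε x + regularize v' σ ε x := rfl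
    rw [this, map_add, smul_add]
  simp only [key]
  refine ⟨by filter_upwards [hi, hi'] with ε a b using a.add b, ?_⟩
  refine (ht.add ht').congr' ?_
  filter_upwards [hi, hi'] with ε a b
  exact (integral_add a b).symm

theorem IsDistribProduct.smul_right {B : E₀ →L[ℂ] E₁ →L[ℂ] E₂}
    {u : 𝓢'(Rd d, E₀)} {v : 𝓢'(Rd d, E₁)} {w : 𝓢'(Rd d, E₂)} (c : ℂ)
    (h : IsDistribProduct B u v w) : IsDistribProduct B u (c • v) (c • w) := by
  intro ρ σ hρ hσ φ
  obtain ⟨hi, ht⟩ := h ρ σ hρ hσ φ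
  have key : ∀ ε x, φ x • B (regularize u ρ ε x) (regularize (c • v) σ ε x)
      = c • (φ x • B (regularize u ρ ε x) (regularize v σ ε x)) := by
    intro ε x
    have : regularize (c • v) σ ε x = c • regularize v σ ε x := rfl
    rw [this, map_smul, smul_comm]
  simp only [key, integral_smul]
  exact ⟨by filter_upwards [hi] with ε a using a.smul c, ht.const_smul c⟩

/-- The Fourier multiplier `μ(D) f = 𝓕⁻¹ (μ • 𝓕 f)` with symbol `μ`, as a partially defined linear
map on tempered distributions. Its domain consists of those `f` for which the product `μ • 𝓕 f`
exists as a tempered distribution. -/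
def fourierMultiplier (B : E₀ →L[ℂ] E₁ →L[ℂ] E₂) (μ : 𝓢'(Rd d, E₀)) :
    𝓢'(Rd d, E₁) →ₗ.[ℂ] 𝓢'(Rd d, E₂) where
  domain :=
    { carrier := {f | ∃ w, IsDistribProduct B μ (𝓕 f) w}
      zero_mem' := ⟨0, by
        have h : 𝓕 (0 : 𝓢'(Rd d, E₁)) = 0 := by ext; simp
        rw [h]; exact IsDistribProduct.zero_right B μ⟩
      add_mem' := by
        rintro f f' ⟨w, h⟩ ⟨w', h'⟩
        exact ⟨w + w', by rw [FourierAdd.fourier_add]; exact h.add_right h'⟩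
      smul_mem' := by
        rintro c f ⟨w, h⟩
        exact ⟨c • w, by rw [fourier_smul]; exact h.smul_right c⟩ }
  toFun :=
    { toFun := fun f => 𝓕⁻ (Classical.choose f.2)
      map_add' := by
        intro f f'
        rw [← fourierInv_add]
        congr 1
        refine (Classical.choose_spec (f + f').2).unique ?_
        have := (Classical.choose_spec f.2).add_right (Classical.choose_spec f'.2)
        rwa [← FourierAdd.fourier_add] at this
      map_smul' := by
        intro c f
        rw [RingHom.id_apply, ← fourierInv_smul]
        congr 1
        refine (Classical.choose_spec (c • f).2).unique ?_
        have := (Classical.choose_spec f.2).smul_right c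
        rwa [← fourier_smul] at this }

theorem fourierMultiplier_eq {B : E₀ →L[ℂ] E₁ →L[ℂ] E₂} {μ : 𝓢'(Rd d, E₀)}
    {f : 𝓢'(Rd d, E₁)} {w : 𝓢'(Rd d, E₂)} (h : IsDistribProduct B μ (𝓕 f) w) :
    fourierMultiplier B μ ⟨f, ⟨w, h⟩⟩ = 𝓕⁻ w := by
  have hf : f ∈ (fourierMultiplier B μ).domain := ⟨w, h⟩
  change 𝓕⁻ (Classical.choose hf) = 𝓕⁻ w
  rw [(Classical.choose_spec hf).unique h]

end Multipliers

end

/-!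
If `∫ h γ = 1`, every Schwartz function is the superposition of the time-frequency shifts of `γ`
with its own short-time Fourier transform with window `h` as amplitude. Applied to the mollifiers,
this writes `(u * ρ_ε) • (v * σ_ε)`, tested against `φ`, as the integral over pairs of points
`(x, ξ)`, `(x', ξ')` of phase space of the products `V u (x, ξ) • V v (x', ξ')` against a mollified
kernel. As `ε → 0` the kernel converges to `∫ φ (y) h₀ (y - x) h₁ (y - x') exp (2πi y·(ξ + ξ')) dy`,
and all these kernels are dominated by a multiple of `⟨x⟩^(-N) ⟨x'⟩^(-N) ⟨ξ + ξ'⟩^(-N)`; hence the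
product exists as soon as the pairs of short-time Fourier transforms are integrable against this
weight.

Testing the limit against the shift of a window by `(x, ξ)` moves the kernel, so that the short-time
Fourier transform of the product is bounded by a pairing concentrated near equal positions `x` and
frequencies with sum `ξ`: a pointwise product in `x` and a convolution in `ξ`. Peetre's inequality
distributes the weights, at the price of `⟨·⟩^|s|` on the first factor, and Minkowski's inequality
bounds the pairing by `‖u‖_(M^{∞,1}_{δ,|s|}) ‖v‖_(M^{p,q}_{r,s})`, where the inner norm is the one
in `x`. Windows are changed by the same estimate for a single distribution. Finally, the Fourier
transform exchanges the amalgam norm of `f` with such a mixed norm of `𝓕 f`, and the multiplier with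
the product.
-/

/-! ### Schwartz seminorms -/

section SchwartzNorm

variable {V F : Type*} [NormedAddCommGroup V] [NormedSpace ℝ V] [NormedAddCommGroup F]
  [NormedSpace ℝ F] [NormedSpace ℂ F] [SMulCommClass ℝ ℂ F]

/-- The supremum of the Schwartz seminorms of orders `(k, n)` with `k, n ≤ m`. As `m` varies, these
increasing norms define the topology of the Schwartz space. -/
noncomputable def schwartzNorm (m : ℕ) : Seminorm ℂ 𝓢(V, F) :=
  (Finset.Iic (m, m)).sup (schwartzSeminormFamily ℂ V F)

theorem one_add_pow_mul_norm_iteratedFDeriv_le (φ : 𝓢(V, F)) {k n m : ℕ} (hk : k ≤ m)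
    (hn : n ≤ m) (y : V) :
    (1 + ‖y‖) ^ k * ‖iteratedFDeriv ℝ n φ y‖ ≤ 2 ^ m * schwartzNorm m φ :=
  one_add_le_sup_seminorm_apply (𝕜 := ℂ) (m := (m, m)) hk hn φ y

theorem one_add_pow_mul_norm_le (φ : 𝓢(V, F)) (m : ℕ) (y : V) :
    (1 + ‖y‖) ^ m * ‖φ y‖ ≤ 2 ^ m * schwartzNorm m φ := by
  simpa only [norm_iteratedFDeriv_zero] using
    one_add_pow_mul_norm_iteratedFDeriv_le φ le_rfl (Nat.zero_le m) y

theorem schwartzNorm_le_of_bound {m : ℕ} {φ : 𝓢(V, F)} {M : ℝ} (hM : 0 ≤ M)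
    (h : ∀ k ≤ m, ∀ n ≤ m, ∀ y, ‖y‖ ^ k * ‖iteratedFDeriv ℝ n φ y‖ ≤ M) :
    schwartzNorm m φ ≤ M := by
  refine Seminorm.finset_sup_apply_le hM fun i hi => ?_
  obtain ⟨hk, hn⟩ := Finset.mem_Iic.1 hi
  exact seminorm_le_bound ℂ i.1 i.2 φ hM (h i.1 hk i.2 hn)

theorem seminorm_le_schwartzNorm {i : ℕ × ℕ} {m : ℕ} (hi : i ≤ (m, m)) (φ : 𝓢(V, F)) :
    schwartzSeminormFamily ℂ V F i φ ≤ schwartzNorm m φ :=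
  Finset.le_sup (f := schwartzSeminormFamily ℂ V F) (Finset.mem_Iic.2 hi) φ

theorem continuous_schwartzNorm (m : ℕ) : Continuous (schwartzNorm m : Seminorm ℂ 𝓢(V, F)) :=
  Seminorm.continuous_finsetSup fun i _ => (schwartz_withSeminorms ℂ V F).continuous_seminorm i

theorem exists_le_schwartzNorm (q : Seminorm ℂ 𝓢(V, F)) (hq : Continuous q) :
    ∃ (m : ℕ) (C : ℝ), 0 ≤ C ∧ ∀ φ, q φ ≤ C * schwartzNorm m φ := by
  obtain ⟨s, C, -, hC⟩ := Seminorm.bound_of_continuous (schwartz_withSeminorms ℂ V F) q hq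
  obtain ⟨b, hb⟩ := s.bddAbove
  have hs : s.sup (schwartzSeminormFamily ℂ V F) ≤ schwartzNorm (max b.1 b.2) :=
    Finset.sup_mono fun i hi => Finset.mem_Iic.2
      ⟨(hb hi).1.trans (le_max_left _ _), (hb hi).2.trans (le_max_right _ _)⟩
  exact ⟨max b.1 b.2, C, C.2, fun φ => (hC φ).trans (mul_le_mul_of_nonneg_left (hs φ) C.2)⟩

theorem exists_norm_le_schwartzNorm {E : Type*} [NormedAddCommGroup E] [NormedSpace ℂ E]
    (v : 𝓢(V, F) →L[ℂ] E) :
    ∃ (m : ℕ) (C : ℝ), 0 ≤ C ∧ ∀ φ, ‖v φ‖ ≤ C * schwartzNorm m φ :=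
  exists_le_schwartzNorm ((normSeminorm ℂ E).comp v.toLinearMap) (continuous_norm.comp v.continuous)

theorem exists_schwartzNorm_map_le (T : 𝓢(V, F) →L[ℂ] 𝓢(V, F)) (m : ℕ) :
    ∃ (m' : ℕ) (C : ℝ), 0 ≤ C ∧ ∀ φ, schwartzNorm m (T φ) ≤ C * schwartzNorm m' φ :=
  exists_le_schwartzNorm ((schwartzNorm m : Seminorm ℂ 𝓢(V, F)).comp T.toLinearMap)
    ((continuous_schwartzNorm m).comp T.continuous)

theorem tendsto_of_tendsto_schwartzNorm {X : Type*} {l : Filter X} {Φ : X → 𝓢(V, F)}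
    {φ : 𝓢(V, F)} (h : ∀ m, Tendsto (fun x => schwartzNorm m (Φ x - φ)) l (𝓝 0)) :
    Tendsto Φ l (𝓝 φ) := by
  refine ((schwartz_withSeminorms ℂ V F).tendsto_nhds Φ φ).2 fun i ε hε => ?_
  filter_upwards [(h (max i.1 i.2)).eventually (gt_mem_nhds hε)] with x hx
  exact (seminorm_le_schwartzNorm ⟨le_max_left _ _, le_max_right _ _⟩ (Φ x - φ)).trans_lt hx

end SchwartzNorm

section Translation

variable {V F : Type*} [NormedAddCommGroup V] [NormedSpace ℝ V] [NormedAddCommGroup F]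
  [NormedSpace ℝ F] [NormedSpace ℂ F]

theorem one_add_norm_le_mul {V : Type*} [SeminormedAddCommGroup V] (x y : V) :
    1 + ‖y‖ ≤ (1 + ‖y - x‖) * (1 + ‖x‖) := by
  have : ‖y‖ ≤ ‖y - x‖ + ‖x‖ := by simpa using norm_add_le (y - x) x
  nlinarith [norm_nonneg (y - x), norm_nonneg x]

theorem iteratedFDeriv_compSubConst (ψ : 𝓢(V, F)) (n : ℕ) (x y : V) :
    iteratedFDeriv ℝ n (compSubConstCLM ℂ x ψ) y = iteratedFDeriv ℝ n ψ (y - x) := by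
  have : (compSubConstCLM ℂ x ψ : V → F) = fun y => ψ (y - x) := rfl
  rw [this, iteratedFDeriv_comp_sub]

variable [SMulCommClass ℝ ℂ F]

theorem schwartzNorm_compSubConst_le (m : ℕ) (x : V) (ψ : 𝓢(V, F)) :
    schwartzNorm m (compSubConstCLM ℂ x ψ) ≤ 2 ^ m * (1 + ‖x‖) ^ m * schwartzNorm m ψ := by
  refine schwartzNorm_le_of_bound (by positivity) fun k hk n hn y => ?_
  rw [iteratedFDeriv_compSubConst]
  calc ‖y‖ ^ k * ‖iteratedFDeriv ℝ n ψ (y - x)‖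
      ≤ ((1 + ‖y - x‖) * (1 + ‖x‖)) ^ k * ‖iteratedFDeriv ℝ n ψ (y - x)‖ := by
        gcongr
        linarith [one_add_norm_le_mul x y]
    _ = (1 + ‖x‖) ^ k * ((1 + ‖y - x‖) ^ k * ‖iteratedFDeriv ℝ n ψ (y - x)‖) := by
        rw [mul_pow]; ring
    _ ≤ (1 + ‖x‖) ^ m * (2 ^ m * schwartzNorm m ψ) :=
        mul_le_mul (pow_le_pow_right₀ (by linarith [norm_nonneg x]) hk)
          (one_add_pow_mul_norm_iteratedFDeriv_le ψ hk hn _) (by positivity) (by positivity)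
    _ = _ := by ring

set_option maxSynthPendingDepth 3 in
theorem norm_pow_mul_norm_iteratedFDeriv_sub_le (ψ : 𝓢(V, F)) {k n m : ℕ} (hk : k ≤ m)
    (hn : n ≤ m) {x : V} (hx : ‖x‖ ≤ 1) (y : V) :
    ‖y‖ ^ k * ‖iteratedFDeriv ℝ n ψ (y - x) - iteratedFDeriv ℝ n ψ y‖
      ≤ 2 ^ (m + 1) * schwartzNorm (m + 1) ψ * ‖x‖ := by
  have hdiff : Differentiable ℝ (iteratedFDeriv ℝ n ψ) :=
    (ψ.smooth ⊤).differentiable_iteratedFDeriv (mod_cast WithTop.coe_lt_top _)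
  have hderiv : ∀ w ∈ Metric.closedBall y 1,
      ‖fderiv ℝ (fun w => ‖y‖ ^ k • iteratedFDeriv ℝ n ψ w) w‖
        ≤ 2 ^ (m + 1) * schwartzNorm (m + 1) ψ := fun w hw => by
    rw [fderiv_fun_const_smul (hdiff w), norm_smul, norm_pow, norm_norm,
      norm_fderiv_iteratedFDeriv]
    refine le_trans ?_ (one_add_pow_mul_norm_iteratedFDeriv_le ψ (k := k) (n := n + 1)
      (m := m + 1) (by lia) (by lia) w)
    gcongr
    have hwy : ‖w - y‖ ≤ 1 := mem_closedBall_iff_norm.1 hw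
    linarith [norm_sub_norm_le y w, norm_sub_rev w y]
  have hmv := (convex_closedBall y 1).norm_image_sub_le_of_norm_fderiv_le (𝕜 := ℝ)
    (x := y) (y := y - x) (fun w _ => (hdiff w).fun_const_smul (‖y‖ ^ k)) hderiv (by simp)
    (by simpa using hx)
  simpa only [← smul_sub, norm_smul, norm_pow, norm_norm, sub_sub_cancel_left, norm_neg] using hmv

theorem schwartzNorm_compSubConst_sub_le (m : ℕ) {x : V} (hx : ‖x‖ ≤ 1) (ψ : 𝓢(V, F)) :
    schwartzNorm m (compSubConstCLM ℂ x ψ - ψ)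
      ≤ 2 ^ (m + 1) * schwartzNorm (m + 1) ψ * ‖x‖ := by
  refine schwartzNorm_le_of_bound (by positivity) fun k hk n hn y => ?_
  have hsub : iteratedFDeriv ℝ n (compSubConstCLM ℂ x ψ - ψ : 𝓢(V, F)) y
      = iteratedFDeriv ℝ n ψ (y - x) - iteratedFDeriv ℝ n ψ y := by
    rw [← iteratedFDeriv_compSubConst]
    exact iteratedFDeriv_sub_apply ((compSubConstCLM ℂ x ψ).contDiffAt _) (ψ.contDiffAt _)
  rw [hsub]
  exact norm_pow_mul_norm_iteratedFDeriv_sub_le ψ hk hn hx y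

theorem continuous_compSubConst (ψ : 𝓢(V, F)) : Continuous fun x => compSubConstCLM ℂ x ψ := by
  refine continuous_iff_continuousAt.2 fun x₀ => tendsto_of_tendsto_schwartzNorm fun m => ?_
  have hlim : Tendsto (fun x : V => 2 ^ m * (1 + ‖x₀‖) ^ m *
      (2 ^ (m + 1) * schwartzNorm (m + 1) ψ * ‖x - x₀‖)) (𝓝 x₀) (𝓝 0) :=
    Continuous.tendsto' (by fun_prop) _ _ (by simp)
  refine squeeze_zero' (Eventually.of_forall fun x => apply_nonneg _ _) ?_ hlim
  filter_upwards [Metric.closedBall_mem_nhds x₀ one_pos] with x hx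
  have htranslate : compSubConstCLM ℂ x ψ - compSubConstCLM ℂ x₀ ψ
      = compSubConstCLM ℂ x₀ (compSubConstCLM ℂ (x - x₀) ψ - ψ) := by
    ext y
    simp
  rw [htranslate]
  refine (schwartzNorm_compSubConst_le _ _ _).trans ?_
  gcongr
  exact schwartzNorm_compSubConst_sub_le m (mem_closedBall_iff_norm.1 hx) ψ

theorem continuous_compSubConst_uncurry :
    Continuous fun p : V × 𝓢(V, F) => compSubConstCLM ℂ p.1 p.2 := by
  refine continuous_iff_continuousAt.2 fun ⟨x₀, ψ₀⟩ =>
    tendsto_of_tendsto_schwartzNorm fun m => ?_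
  have hbound : Continuous fun p : V × 𝓢(V, F) =>
      2 ^ m * (1 + ‖p.1‖) ^ m * schwartzNorm m (p.2 - ψ₀)
        + schwartzNorm m (compSubConstCLM ℂ p.1 ψ₀ - compSubConstCLM ℂ x₀ ψ₀) := by
    have h1 := (continuous_schwartzNorm m).comp (continuous_snd.sub
      (continuous_const (X := V × 𝓢(V, F)) (y := ψ₀)))
    have h2 := (continuous_schwartzNorm m).comp
      (((continuous_compSubConst ψ₀).comp (continuous_fst (X := V) (Y := 𝓢(V, F)))).sub
        (continuous_const (y := compSubConstCLM ℂ x₀ ψ₀)))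
    exact (Continuous.mul (by fun_prop) h1).add h2
  refine squeeze_zero (fun p => apply_nonneg _ _) (fun p => ?_)
    (hbound.tendsto' (x₀, ψ₀) 0 (by simp))
  have hsplit : compSubConstCLM ℂ p.1 p.2 - compSubConstCLM ℂ x₀ ψ₀
      = compSubConstCLM ℂ p.1 (p.2 - ψ₀)
        + (compSubConstCLM ℂ p.1 ψ₀ - compSubConstCLM ℂ x₀ ψ₀) := by
    rw [map_sub]; abel
  rw [hsplit]
  refine (map_add_le_add _ _ _).trans ?_
  gcongr
  exact schwartzNorm_compSubConst_le _ _ _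

/-- Multiplication of Schwartz functions by the translate `h (· - x)`, i.e. localization near
`x`. -/
noncomputable def mulShift (h : 𝓢(V, ℂ)) (x : V) : 𝓢(V, ℂ) →L[ℂ] 𝓢(V, ℂ) :=
  pairing (ContinuousLinearMap.mul ℂ ℂ) (compSubConstCLM ℂ x h)

theorem mulShift_apply (h : 𝓢(V, ℂ)) (x : V) (φ : 𝓢(V, ℂ)) (y : V) :
    mulShift h x φ y = h (y - x) * φ y := by
  simp [mulShift]

theorem norm_iteratedFDeriv_mulShift_le (h φ : 𝓢(V, ℂ)) (n : ℕ) (x y : V) :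
    ‖iteratedFDeriv ℝ n (mulShift h x φ) y‖ ≤ ∑ i ∈ Finset.range (n + 1),
      (n.choose i : ℝ) * ‖iteratedFDeriv ℝ i h (y - x)‖ * ‖iteratedFDeriv ℝ (n - i) φ y‖ := by
  have hcoe : (mulShift h x φ : V → ℂ) = fun y => (compSubConstCLM ℂ x h) y * φ y := by
    ext y; simp [mulShift]
  simp only [hcoe, ← iteratedFDeriv_compSubConst]
  exact norm_iteratedFDeriv_mul_le ((compSubConstCLM ℂ x h).smooth ⊤) (φ.smooth ⊤) y
    (mod_cast le_top)

theorem exists_schwartzNorm_mulShift_le (h : 𝓢(V, ℂ)) (m N : ℕ) :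
    ∃ C : ℝ, 0 ≤ C ∧ ∀ (x : V) (φ : 𝓢(V, ℂ)),
      (1 + ‖x‖) ^ N * schwartzNorm m (mulShift h x φ) ≤ C * schwartzNorm (m + N) φ := by
  set M : ℝ := 2 ^ (m + N)
  refine ⟨2 ^ m * (M * schwartzNorm (m + N) h * M), by positivity, fun x φ => ?_⟩
  rw [mul_comm, ← le_div_iff₀ (by positivity)]
  refine schwartzNorm_le_of_bound (by positivity) fun k hk n hn y => ?_
  rw [le_div_iff₀ (by positivity)]
  have hx : 1 + ‖x‖ ≤ (1 + ‖y - x‖) * (1 + ‖y‖) := by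
    simpa only [norm_sub_rev] using one_add_norm_le_mul y x
  calc ‖y‖ ^ k * ‖iteratedFDeriv ℝ n (mulShift h x φ) y‖ * (1 + ‖x‖) ^ N
      ≤ (1 + ‖y‖) ^ k * (∑ i ∈ Finset.range (n + 1),
          (n.choose i : ℝ) * ‖iteratedFDeriv ℝ i h (y - x)‖ * ‖iteratedFDeriv ℝ (n - i) φ y‖)
          * ((1 + ‖y - x‖) * (1 + ‖y‖)) ^ N := by
        gcongr
        · linarith
        · exact norm_iteratedFDeriv_mulShift_le h φ n x y
    _ = ∑ i ∈ Finset.range (n + 1), (n.choose i : ℝ) *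
          (((1 + ‖y - x‖) ^ N * ‖iteratedFDeriv ℝ i h (y - x)‖) *
          ((1 + ‖y‖) ^ (k + N) * ‖iteratedFDeriv ℝ (n - i) φ y‖)) := by
        rw [Finset.mul_sum, Finset.sum_mul]
        refine Finset.sum_congr rfl fun i _ => ?_
        rw [mul_pow, pow_add]
        ring
    _ ≤ ∑ i ∈ Finset.range (n + 1), (n.choose i : ℝ) *
          ((M * schwartzNorm (m + N) h) * (M * schwartzNorm (m + N) φ)) := by
        refine Finset.sum_le_sum fun i hi => mul_le_mul_of_nonneg_left ?_ (Nat.cast_nonneg _)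
        have hin : i ≤ n := Nat.lt_succ_iff.1 (Finset.mem_range.1 hi)
        exact mul_le_mul (one_add_pow_mul_norm_iteratedFDeriv_le h (by lia) (by lia) _)
          (one_add_pow_mul_norm_iteratedFDeriv_le φ (by lia) (by lia) _)
          (by positivity) (by positivity)
    _ = 2 ^ n * ((M * schwartzNorm (m + N) h) * (M * schwartzNorm (m + N) φ)) := by
        rw [← Finset.sum_mul]
        exact_mod_cast congrArg (· * _) (congrArg (Nat.cast (R := ℝ)) (Nat.sum_range_choose n))
    _ ≤ 2 ^ m * ((M * schwartzNorm (m + N) h) * (M * schwartzNorm (m + N) φ)) := by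
        gcongr
        norm_num
    _ = _ := by ring

end Translation

/-! ### Time-frequency shifts -/

section Characters

variable {d : ℕ}

@[simp]
theorem norm_negCharacter (ξ y : Rd d) : ‖negCharacter ξ y‖ = 1 :=
  Complex.norm_exp_ofReal_mul_I _

theorem negCharacter_comm (ξ y : Rd d) : negCharacter ξ y = negCharacter y ξ := by
  simp only [negCharacter, real_inner_comm]

theorem negCharacter_add_left (ξ η y : Rd d) :
    negCharacter (ξ + η) y = negCharacter ξ y * negCharacter η y := by
  simp only [negCharacter, ← Complex.exp_add, inner_add_right]
  congr 1
  push_cast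
  ring

theorem negCharacter_add_right (ξ x y : Rd d) :
    negCharacter ξ (x + y) = negCharacter ξ x * negCharacter ξ y := by
  simp only [negCharacter_comm ξ, negCharacter_add_left]

theorem negCharacter_neg_left (ξ y : Rd d) : negCharacter (-ξ) y = negCharacter ξ (-y) := by
  simp [negCharacter]

@[simp]
theorem negCharacter_zero_left (y : Rd d) : negCharacter 0 y = 1 := by
  simp [negCharacter]

theorem continuous_negCharacter : Continuous fun p : Rd d × Rd d => negCharacter p.1 p.2 := by
  unfold negCharacter
  fun_prop

@[fun_prop]
theorem continuous_negCharacter_comp {X : Type*} [TopologicalSpace X] {f g : X → Rd d}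
    (hf : Continuous f) (hg : Continuous g) : Continuous fun x => negCharacter (f x) (g x) :=
  continuous_negCharacter.comp (hf.prodMk hg)

theorem fourierInv_schwartz_apply (φ : 𝓢(Rd d, ℂ)) (t : Rd d) :
    (𝓕⁻ φ) t = ∫ y, negCharacter (-t) y * φ y := by
  rw [fourierInv_coe, Real.fourierInv_eq']
  refine integral_congr_ae (Eventually.of_forall fun y => ?_)
  simp [negCharacter, inner_neg_right]

theorem fourier_schwartz_apply (φ : 𝓢(Rd d, ℂ)) (t : Rd d) :
    (𝓕 φ) t = ∫ y, negCharacter t y * φ y := by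
  rw [fourier_coe, Real.fourier_eq']
  refine integral_congr_ae (Eventually.of_forall fun y => ?_)
  simp [negCharacter]

end Characters

section TimeFrequencyShifts

variable {d : ℕ}

/-- The time-frequency shift `M_{-ξ} T_x γ`, i.e. `y ↦ exp (-2πi y·ξ) * γ (y - x)`. The sign of the
frequency is that of `conjTFShift`, so that `conjTFShift g` is `tfShift` of the conjugate of `g`. -/
noncomputable def tfShift (γ : 𝓢(Rd d, ℂ)) (x ξ : Rd d) : 𝓢(Rd d, ℂ) :=
  smulLeftCLM ℂ (negCharacter ξ) (compSubConstCLM ℂ x γ)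

theorem tfShift_apply (γ : 𝓢(Rd d, ℂ)) (x ξ y : Rd d) :
    tfShift γ x ξ y = negCharacter ξ y * γ (y - x) := by
  simp [tfShift, smulLeftCLM_apply_apply (hasTemperateGrowth_negCharacter ξ)]

theorem fourierInv_tfShift (γ : 𝓢(Rd d, ℂ)) (x ξ : Rd d) :
    𝓕⁻ (tfShift γ x ξ) = negCharacter ξ x • tfShift (𝓕⁻ γ) ξ (-x) := by
  ext t
  have h : (𝓕⁻ (tfShift γ x ξ)) t
      = ∫ y, negCharacter (-t) (y + x) * tfShift γ x ξ (y + x) := by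
    rw [fourierInv_schwartz_apply]
    exact (integral_add_right_eq_self (fun y => negCharacter (-t) y * tfShift γ x ξ y) x).symm
  rw [h]
  simp only [_root_.smul_apply, tfShift_apply, smul_eq_mul]
  rw [fourierInv_schwartz_apply, ← integral_const_mul, ← integral_const_mul]
  refine integral_congr_ae (Eventually.of_forall fun y => ?_)
  have h1 : -(t - ξ) = -t + ξ := by abel
  simp only [add_sub_cancel_right, h1, negCharacter_add_right, negCharacter_add_left]
  rw [negCharacter_neg_left t x, negCharacter_comm t (-x)]
  ring

theorem tfShift_zero_right (γ : 𝓢(Rd d, ℂ)) (x : Rd d) :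
    tfShift γ x 0 = compSubConstCLM ℂ x γ := by
  ext y
  simp [tfShift_apply]

theorem tfShift_zero_left (γ : 𝓢(Rd d, ℂ)) (ξ : Rd d) :
    tfShift γ 0 ξ = 𝓕 (compSubConstCLM ℂ ξ (𝓕⁻ γ)) := by
  have h := fourierInv_tfShift γ 0 ξ
  rw [neg_zero, negCharacter_comm, negCharacter_zero_left, one_smul, tfShift_zero_right] at h
  rw [← h, FourierTransform.fourier_fourierInv_eq]

theorem tfShift_eq (γ : 𝓢(Rd d, ℂ)) (x ξ : Rd d) :
    tfShift γ x ξ = negCharacter ξ x • compSubConstCLM ℂ x (tfShift γ 0 ξ) := by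
  ext y
  simp only [tfShift_apply, _root_.smul_apply, compSubConstCLM_apply, sub_zero, smul_eq_mul]
  rw [← mul_assoc, ← negCharacter_add_right]
  simp

theorem continuous_tfShift (γ : 𝓢(Rd d, ℂ)) :
    Continuous fun p : Rd d × Rd d => tfShift γ p.1 p.2 := by
  have h : Continuous fun p : Rd d × Rd d => compSubConstCLM ℂ p.1 (tfShift γ 0 p.2) := by
    simp only [tfShift_zero_left]
    exact continuous_compSubConst_uncurry.comp (continuous_fst.prodMk
      ((fourierCLM ℂ 𝓢(Rd d, ℂ)).continuous.comp
        (continuous_compSubConst_uncurry.comp (continuous_snd.prodMk continuous_const))))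
  have hchar : Continuous fun p : Rd d × Rd d => negCharacter p.2 p.1 := by fun_prop
  simp only [funext fun p : Rd d × Rd d => tfShift_eq γ p.1 p.2]
  exact hchar.smul h

theorem exists_schwartzNorm_tfShift_le (γ : 𝓢(Rd d, ℂ)) (m : ℕ) :
    ∃ (N : ℕ) (C : ℝ), 0 ≤ C ∧ ∀ x ξ : Rd d,
      schwartzNorm m (tfShift γ x ξ) ≤ C * (1 + ‖x‖) ^ N * (1 + ‖ξ‖) ^ N := by
  obtain ⟨m', C, hC, h⟩ := exists_schwartzNorm_map_le (fourierCLM ℂ 𝓢(Rd d, ℂ)) m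
  refine ⟨max m m', 2 ^ m * (C * (2 ^ m' * schwartzNorm m' (𝓕⁻ γ))), by positivity,
    fun x ξ => ?_⟩
  rw [tfShift_eq, map_smul_eq_mul, norm_negCharacter, one_mul]
  have hx : (1 + ‖x‖) ^ m ≤ (1 + ‖x‖) ^ max m m' :=
    pow_le_pow_right₀ (by linarith [norm_nonneg x]) (le_max_left _ _)
  have hξ : (1 + ‖ξ‖) ^ m' ≤ (1 + ‖ξ‖) ^ max m m' :=
    pow_le_pow_right₀ (by linarith [norm_nonneg ξ]) (le_max_right _ _)
  calc schwartzNorm m (compSubConstCLM ℂ x (tfShift γ 0 ξ))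
      ≤ 2 ^ m * (1 + ‖x‖) ^ m * schwartzNorm m (tfShift γ 0 ξ) :=
        schwartzNorm_compSubConst_le _ _ _
    _ ≤ 2 ^ m * (1 + ‖x‖) ^ m *
          (C * (2 ^ m' * (1 + ‖ξ‖) ^ m' * schwartzNorm m' (𝓕⁻ γ))) := by
        rw [tfShift_zero_left]
        gcongr
        refine (h _).trans ?_
        gcongr
        exact schwartzNorm_compSubConst_le _ _ _
    _ ≤ 2 ^ m * (1 + ‖x‖) ^ max m m' *
          (C * (2 ^ m' * (1 + ‖ξ‖) ^ max m m' * schwartzNorm m' (𝓕⁻ γ))) := by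
        gcongr
    _ = _ := by ring

theorem mulShift_tfShift (h γ : 𝓢(Rd d, ℂ)) (x x₀ ξ₀ : Rd d) :
    mulShift h x (tfShift γ x₀ ξ₀) = tfShift (mulShift h (x - x₀) γ) x₀ ξ₀ := by
  ext y
  simp only [mulShift_apply, tfShift_apply, sub_sub_sub_cancel_right]
  ring

/-- The coefficient `∫ φ (y) h (y - x) exp (2πi y·ξ) dy` of `tfShift γ x ξ` in the expansion of `φ`
into time-frequency shifts of `γ`, where `h` is a window dual to `γ`. It is irreducible to keep the
unifier from unfolding it to the integral. -/
@[irreducible]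
noncomputable def tfCoeff (h φ : 𝓢(Rd d, ℂ)) (x ξ : Rd d) : ℂ :=
  (𝓕⁻ (mulShift h x φ)) ξ

theorem tfCoeff_eq (h φ : 𝓢(Rd d, ℂ)) (x ξ : Rd d) :
    tfCoeff h φ x ξ = ∫ y, negCharacter (-ξ) y * (h (y - x) * φ y) := by
  rw [tfCoeff, fourierInv_schwartz_apply]
  simp only [mulShift_apply]

theorem norm_tfCoeff_tfShift (h γ : 𝓢(Rd d, ℂ)) (x ξ x₀ ξ₀ : Rd d) :
    ‖tfCoeff h (tfShift γ x₀ ξ₀) x ξ‖ = ‖tfCoeff h γ (x - x₀) (ξ - ξ₀)‖ := by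
  rw [tfCoeff, mulShift_tfShift, fourierInv_tfShift]
  simp [tfShift_apply, tfCoeff]

theorem exists_norm_tfCoeff_le (h : 𝓢(Rd d, ℂ)) (N : ℕ) :
    ∃ (m : ℕ) (C : ℝ), 0 ≤ C ∧ ∀ (φ : 𝓢(Rd d, ℂ)) (x ξ : Rd d),
      (1 + ‖x‖) ^ N * (1 + ‖ξ‖) ^ N * ‖tfCoeff h φ x ξ‖ ≤ C * schwartzNorm m φ := by
  obtain ⟨m, C, hC, hm⟩ := exists_schwartzNorm_map_le (fourierInvCLM ℂ 𝓢(Rd d, ℂ)) N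
  obtain ⟨C', hC', hm'⟩ := exists_schwartzNorm_mulShift_le h m N
  refine ⟨m + N, 2 ^ N * (C * C'), by positivity, fun φ x ξ => ?_⟩
  calc (1 + ‖x‖) ^ N * (1 + ‖ξ‖) ^ N * ‖tfCoeff h φ x ξ‖
      = (1 + ‖x‖) ^ N * ((1 + ‖ξ‖) ^ N * ‖tfCoeff h φ x ξ‖) := by ring
    _ ≤ (1 + ‖x‖) ^ N * (2 ^ N * (C * schwartzNorm m (mulShift h x φ))) := by
        rw [tfCoeff]
        refine mul_le_mul_of_nonneg_left ((one_add_pow_mul_norm_le _ N ξ).trans ?_)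
          (by positivity)
        exact mul_le_mul_of_nonneg_left (hm _) (by positivity)
    _ = 2 ^ N * (C * ((1 + ‖x‖) ^ N * schwartzNorm m (mulShift h x φ))) := by ring
    _ ≤ 2 ^ N * (C * (C' * schwartzNorm (m + N) φ)) := by
        have := hm' x φ
        gcongr 2 ^ N * (C * ?_)
    _ = _ := by ring

theorem exists_norm_le (h : 𝓢(Rd d, ℂ)) : ∃ C : ℝ, ∀ y, ‖h y‖ ≤ C :=
  ⟨schwartzNorm 0 h, fun y => by simpa using one_add_pow_mul_norm_le h 0 y⟩

theorem continuous_integral_negCharacter_mul {X : Type*} [TopologicalSpace X]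
    [FirstCountableTopology X] {ξ : X → Rd d} (hξ : Continuous ξ) {k : X → Rd d → ℂ}
    (hk : Continuous fun p : X × Rd d => k p.1 p.2) {C : ℝ} (hC : ∀ x y, ‖k x y‖ ≤ C)
    (φ : 𝓢(Rd d, ℂ)) : Continuous fun x => ∫ y, negCharacter (ξ x) y * (k x y * φ y) := by
  have hkx (x : X) : Continuous (k x) := hk.comp (by fun_prop : Continuous fun y => (x, y))
  have hky (y : Rd d) : Continuous fun x => k x y := hk.comp (by fun_prop : Continuous (·, y))
  refine continuous_of_dominated (bound := fun y => C * ‖φ y‖)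
    (fun x => Continuous.aestronglyMeasurable (by fun_prop))
    (fun x => Eventually.of_forall fun y => ?_) (φ.integrable.norm.const_mul _)
    (Eventually.of_forall fun y => by fun_prop)
  rw [norm_mul, norm_negCharacter, one_mul, norm_mul]
  exact mul_le_mul_of_nonneg_right (hC x y) (norm_nonneg _)

theorem continuous_tfCoeff_mulShift (h h' φ : 𝓢(Rd d, ℂ)) :
    Continuous fun p : Rd d × Rd d × Rd d => tfCoeff h (mulShift h' p.2.1 φ) p.1 p.2.2 := by
  obtain ⟨C, hC⟩ := exists_norm_le h
  obtain ⟨C', hC'⟩ := exists_norm_le h'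
  simp only [tfCoeff_eq, mulShift_apply, ← mul_assoc (h _)]
  refine continuous_integral_negCharacter_mul (C := C * C') (by fun_prop) (by fun_prop)
    (fun p y => ?_) φ
  rw [norm_mul]
  exact mul_le_mul (hC _) (hC' _) (norm_nonneg _) ((norm_nonneg _).trans (hC 0))

theorem continuous_tfCoeff (h φ : 𝓢(Rd d, ℂ)) :
    Continuous fun p : Rd d × Rd d => tfCoeff h φ p.1 p.2 := by
  obtain ⟨C, hC⟩ := exists_norm_le h
  simp only [tfCoeff_eq]
  exact continuous_integral_negCharacter_mul (by fun_prop) (by fun_prop) (fun p y => hC _) φ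

end TimeFrequencyShifts

section IntegralOfSchwartz

set_option maxSynthPendingDepth 3

open scoped BoundedContinuousFunction

theorem clm_apply_eq_integral_of_norm_le {𝕜 X E F Z : Type*} [RCLike 𝕜] [TopologicalSpace X]
    [AddCommGroup X] [Module 𝕜 X] [NormedAddCommGroup E] [NormedSpace 𝕜 E] [NormedSpace ℝ E]
    [CompleteSpace E] [NormedAddCommGroup F] [NormedSpace 𝕜 F] [NormedSpace ℝ F] [CompleteSpace F]
    [MeasurableSpace Z] [TopologicalSpace Z] [OpensMeasurableSpace Z] [SecondCountableTopology Z]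
    {ν : Measure Z} (v : X →L[𝕜] E) (W : X →L[𝕜] F) {C : ℝ} (hvW : ∀ x, ‖v x‖ ≤ C * ‖W x‖)
    {Φ : Z → X} (hΦ : Continuous Φ) (hint : Integrable (fun z => W (Φ z)) ν) {x : X}
    (hx : W x = ∫ z, W (Φ z) ∂ν) : v x = ∫ z, v (Φ z) ∂ν := by
  let S := (LinearMap.range W.toLinearMap).topologicalClosure
  have hS : CompleteSpace S := (Submodule.isClosed_topologicalClosure _).completeSpace_coe
  let e : X →L[𝕜] S := W.codRestrict S fun x => subset_closure ⟨x, rfl⟩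
  have he : DenseRange e := by
    refine fun y => closure_subtype.2 ?_
    rw [← Set.range_comp]
    exact y.2
  have heint : Integrable (fun z => e (Φ z)) ν :=
    hint.mono (e.continuous.comp hΦ).aestronglyMeasurable (Eventually.of_forall fun z => le_rfl)
  have hex : e x = ∫ z, e (Φ z) ∂ν := by
    refine Subtype.ext (hx.trans ?_)
    exact S.subtypeL.integral_comp_comm heint
  have hext := v.toLinearMap.extendOfNorm_eq (e := e.toLinearMap) he ⟨C, hvW⟩
  calc v x = v.toLinearMap.extendOfNorm e.toLinearMap (e x) := (hext x).symm
    _ = ∫ z, v.toLinearMap.extendOfNorm e.toLinearMap (e (Φ z)) ∂ν := by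
      rw [hex, ContinuousLinearMap.integral_comp_comm _ heint]
    _ = ∫ z, v (Φ z) ∂ν := by congr 1 with z; exact hext (Φ z)

variable {V : Type*} [NormedAddCommGroup V] [NormedSpace ℝ V]

/-- The value of the `n`-th derivative of a Schwartz function at a point, as a continuous linear
map. -/
noncomputable def iteratedFDerivEvalCLM (n : ℕ) (y : V) : 𝓢(V, ℂ) →L[ℂ] V [×n]→L[ℝ] ℂ :=
  mkCLMtoNormedSpace (fun φ => iteratedFDeriv ℝ n φ y)
    (fun φ ψ => iteratedFDeriv_add_apply (φ.contDiffAt _) (ψ.contDiffAt _))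
    (fun _ φ => iteratedFDeriv_const_smul_apply (φ.contDiffAt _))
    ⟨{(0, n)}, 1, zero_le_one, fun φ => by
      simpa using norm_iteratedFDeriv_le_seminorm ℂ φ n y⟩

theorem norm_one_add_pow_smul_iteratedFDeriv_le (φ : 𝓢(V, ℂ)) (m : ℕ) (y : V) :
    ‖fun n : Fin (m + 1) => (1 + ‖y‖) ^ m • iteratedFDeriv ℝ n φ y‖ ≤ 2 ^ m * schwartzNorm m φ := by
  refine (pi_norm_le_iff_of_nonneg (mul_nonneg (by positivity) (apply_nonneg _ _))).2 fun n => ?_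
  rw [norm_smul, norm_pow, Real.norm_of_nonneg (by positivity)]
  exact one_add_pow_mul_norm_iteratedFDeriv_le φ le_rfl (Nat.lt_succ_iff.1 n.2) y

/-- The weighted derivatives `(1 + ‖y‖) ^ m • iteratedFDeriv ℝ n φ y`, `n ≤ m`, of a Schwartz
function. Its target is a Banach space, in which the integral of a family of Schwartz functions
makes sense, and its norm dominates `schwartzNorm m`. -/
noncomputable def weightedDerivs (m : ℕ) :
    𝓢(V, ℂ) →L[ℂ] V →ᵇ ∀ n : Fin (m + 1), V [×n]→L[ℝ] ℂ :=
  mkCLMtoNormedSpace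
    (fun φ => BoundedContinuousFunction.ofNormedAddCommGroup
      (fun y (n : Fin (m + 1)) => (1 + ‖y‖) ^ m • iteratedFDeriv ℝ n φ y)
      (continuous_pi fun n => by
        have := (φ.smooth ⊤).continuous_iteratedFDeriv (m := n) (mod_cast le_top)
        fun_prop)
      (2 ^ m * schwartzNorm m φ) (norm_one_add_pow_smul_iteratedFDeriv_le φ m))
    (fun φ ψ => by
      ext1 y; funext n
      exact (congrArg _ ((iteratedFDerivEvalCLM n y).map_add φ ψ)).trans (smul_add _ _ _))
    (fun a φ => by
      ext1 y; funext n
      exact (congrArg _ ((iteratedFDerivEvalCLM n y).map_smul a φ)).trans (smul_comm _ _ _))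
    ⟨Finset.Iic (m, m), 2 ^ m, by positivity, fun φ =>
      (BoundedContinuousFunction.norm_le (mul_nonneg (by positivity) (apply_nonneg _ _))).2
        (norm_one_add_pow_smul_iteratedFDeriv_le φ m)⟩

theorem schwartzNorm_le_norm_weightedDerivs (m : ℕ) (φ : 𝓢(V, ℂ)) :
    schwartzNorm m φ ≤ ‖weightedDerivs m φ‖ := by
  refine schwartzNorm_le_of_bound (norm_nonneg _) fun k hk n hn y => ?_
  calc ‖y‖ ^ k * ‖iteratedFDeriv ℝ n φ y‖
      ≤ (1 + ‖y‖) ^ m * ‖iteratedFDeriv ℝ n φ y‖ := by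
        gcongr
        exact (pow_le_pow_left₀ (norm_nonneg y) (by linarith) k).trans
          (pow_le_pow_right₀ (by linarith [norm_nonneg y]) hk)
    _ = ‖weightedDerivs m φ y ⟨n, Nat.lt_succ_iff.2 hn⟩‖ := by
        change _ = ‖(1 + ‖y‖) ^ m • iteratedFDeriv ℝ n φ y‖
        rw [norm_smul, norm_pow, Real.norm_of_nonneg (by positivity)]
    _ ≤ ‖weightedDerivs m φ‖ :=
        (norm_le_pi_norm _ _).trans ((weightedDerivs m φ).norm_coe_le_norm y)

variable {Z : Type*} [MeasurableSpace Z] [TopologicalSpace Z] [OpensMeasurableSpace Z]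
  [SecondCountableTopology Z] {ν : Measure Z} {Φ : Z → 𝓢(V, ℂ)} {φ : 𝓢(V, ℂ)}

theorem integrable_clm_comp {E : Type*} [NormedAddCommGroup E] [NormedSpace ℂ E]
    (v : 𝓢(V, ℂ) →L[ℂ] E) (hΦ : Continuous Φ)
    (hint : ∀ m, Integrable (fun z => schwartzNorm m (Φ z)) ν) :
    Integrable (fun z => v (Φ z)) ν := by
  obtain ⟨m, C, -, hv⟩ := exists_norm_le_schwartzNorm v
  exact ((hint m).const_mul C).mono' (v.continuous.comp hΦ).aestronglyMeasurable
    (Eventually.of_forall fun z => hv _)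

theorem fderiv_iteratedFDeriv_eq_curryLeft (ψ : 𝓢(V, ℂ)) (n : ℕ) (y : V) :
    fderiv ℝ (iteratedFDeriv ℝ n ψ) y = (iteratedFDeriv ℝ (n + 1) ψ y).curryLeft := by
  rw [iteratedFDeriv_succ_eq_comp_left]
  exact ((continuousMultilinearCurryLeftEquiv ℝ (fun _ : Fin (n + 1) => V) ℂ).apply_symm_apply
    _).symm

theorem hasFDerivAt_integral_iteratedFDeriv (hΦ : Continuous Φ)
    (hint : ∀ m, Integrable (fun z => schwartzNorm m (Φ z)) ν) (n : ℕ) (y : V) :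
    HasFDerivAt (fun w => ∫ z, iteratedFDeriv ℝ n (Φ z) w ∂ν)
      (∫ z, (iteratedFDeriv ℝ (n + 1) (Φ z) y).curryLeft ∂ν) y := by
  have hI (n : ℕ) (w : V) : Integrable (fun z => iteratedFDeriv ℝ n (Φ z) w) ν :=
    integrable_clm_comp (iteratedFDerivEvalCLM n w) hΦ hint
  refine hasFDerivAt_integral_of_dominated_of_fderiv_le (𝕜 := ℝ)
    (F' := fun w z => (iteratedFDeriv ℝ (n + 1) (Φ z) w).curryLeft)
    (bound := fun z => 2 ^ (n + 1) * schwartzNorm (n + 1) (Φ z)) univ_mem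
    (Eventually.of_forall fun w => (hI n w).aestronglyMeasurable) (hI n y) ?_
    (Eventually.of_forall fun z w _ => ?_) ((hint _).const_mul _)
    (Eventually.of_forall fun z w _ => ?_)
  · exact (continuousMultilinearCurryLeftEquiv ℝ (fun _ : Fin (n + 1) => V)
      ℂ).continuous.comp_aestronglyMeasurable (hI (n + 1) y).aestronglyMeasurable
  · rw [← fderiv_iteratedFDeriv_eq_curryLeft, norm_fderiv_iteratedFDeriv]
    simpa using one_add_pow_mul_norm_iteratedFDeriv_le (Φ z) (Nat.zero_le _) le_rfl w
  · rw [← fderiv_iteratedFDeriv_eq_curryLeft]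
    exact ((((Φ z).smooth ⊤).differentiable_iteratedFDeriv
      (mod_cast WithTop.coe_lt_top _)) w).hasFDerivAt

theorem iteratedFDeriv_eq_integral (hΦ : Continuous Φ)
    (hint : ∀ m, Integrable (fun z => schwartzNorm m (Φ z)) ν)
    (hφ : ∀ y, φ y = ∫ z, Φ z y ∂ν) (n : ℕ) (y : V) :
    iteratedFDeriv ℝ n φ y = ∫ z, iteratedFDeriv ℝ n (Φ z) y ∂ν := by
  induction n generalizing y with
  | zero =>
    ext t
    have hI : Integrable (fun z => iteratedFDeriv ℝ 0 (Φ z) y) ν :=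
      integrable_clm_comp (iteratedFDerivEvalCLM 0 y) hΦ hint
    rw [ContinuousMultilinearMap.integral_apply hI]
    simpa only [iteratedFDeriv_zero_apply] using hφ y
  | succ n ih =>
    let curry := continuousMultilinearCurryLeftEquiv ℝ (fun _ : Fin (n + 1) => V) ℂ
    apply curry.injective
    calc curry (iteratedFDeriv ℝ (n + 1) φ y)
        = ∫ z, curry (iteratedFDeriv ℝ (n + 1) (Φ z) y) ∂ν := by
          refine (fderiv_iteratedFDeriv_eq_curryLeft φ n y).symm.trans ?_
          rw [funext ih]
          exact (hasFDerivAt_integral_iteratedFDeriv hΦ hint n y).fderiv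
      _ = curry (∫ z, iteratedFDeriv ℝ (n + 1) (Φ z) y ∂ν) :=
          curry.toContinuousLinearEquiv.toContinuousLinearMap.integral_comp_comm
            (integrable_clm_comp (iteratedFDerivEvalCLM (n + 1) y) hΦ hint)

theorem weightedDerivs_eq_integral (hΦ : Continuous Φ)
    (hint : ∀ m, Integrable (fun z => schwartzNorm m (Φ z)) ν)
    (hφ : ∀ y, φ y = ∫ z, Φ z y ∂ν) (m : ℕ) :
    weightedDerivs m φ = ∫ z, weightedDerivs m (Φ z) ∂ν := by
  ext1 y
  funext n
  let component : (V →ᵇ ∀ n : Fin (m + 1), V [×n]→L[ℝ] ℂ) →L[ℂ] V [×n]→L[ℝ] ℂ :=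
    (ContinuousLinearMap.proj (R := ℂ) (φ := fun n : Fin (m + 1) => V [×n]→L[ℝ] ℂ) n).comp
      (BoundedContinuousFunction.evalCLM ℂ y)
  have hcomponent (ψ : 𝓢(V, ℂ)) :
      component (weightedDerivs m ψ) = (1 + ‖y‖) ^ m • iteratedFDeriv ℝ n ψ y := rfl
  calc weightedDerivs m φ y n = ∫ z, component (weightedDerivs m (Φ z)) ∂ν := by
        simp only [hcomponent]
        rw [integral_smul, ← iteratedFDeriv_eq_integral hΦ hint hφ]
        rfl
    _ = component (∫ z, weightedDerivs m (Φ z) ∂ν) := by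
        have hI := integrable_clm_comp (weightedDerivs m) hΦ hint
        exact component.integral_comp_comm hI

theorem clm_apply_eq_integral {E : Type*} [NormedAddCommGroup E] [NormedSpace ℂ E]
    [CompleteSpace E] (v : 𝓢(V, ℂ) →L[ℂ] E) (hΦ : Continuous Φ)
    (hint : ∀ m, Integrable (fun z => schwartzNorm m (Φ z)) ν)
    (hφ : ∀ y, φ y = ∫ z, Φ z y ∂ν) : v φ = ∫ z, v (Φ z) ∂ν := by
  obtain ⟨m, C, hC, hv⟩ := exists_norm_le_schwartzNorm v
  exact clm_apply_eq_integral_of_norm_le v (weightedDerivs m)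
    (fun ψ => (hv ψ).trans (mul_le_mul_of_nonneg_left
      (schwartzNorm_le_norm_weightedDerivs m ψ) hC)) hΦ
    (integrable_clm_comp (weightedDerivs m) hΦ hint) (weightedDerivs_eq_integral hΦ hint hφ m)

end IntegralOfSchwartz

/-! ### Weights and the reproducing formula -/

section Brackets

variable {d : ℕ}

theorem one_le_one_add_norm_sq (x : Rd d) : 1 ≤ 1 + ‖x‖ ^ 2 := by
  linarith [sq_nonneg ‖x‖]

theorem bracketPow_pos (r : ℝ) (x : Rd d) : 0 < bracketPow r x :=
  Real.rpow_pos_of_pos (by positivity) _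

theorem bracketPow_nonneg (r : ℝ) (x : Rd d) : 0 ≤ bracketPow r x := (bracketPow_pos r x).le

@[fun_prop]
theorem continuous_bracketPow (r : ℝ) : Continuous (bracketPow r : Rd d → ℝ) := by
  unfold bracketPow
  refine Continuous.rpow_const (by fun_prop) fun x => Or.inl ?_
  positivity

theorem bracketPow_add (r s : ℝ) (x : Rd d) :
    bracketPow (r + s) x = bracketPow r x * bracketPow s x := by
  simp only [bracketPow, add_div]
  exact Real.rpow_add (by positivity) _ _

theorem bracketPow_neg_mul (r : ℝ) (x : Rd d) : bracketPow (-r) x * bracketPow r x = 1 := by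
  rw [← bracketPow_add]
  simp [bracketPow]

theorem bracketPow_neg_arg (r : ℝ) (x : Rd d) : bracketPow r (-x) = bracketPow r x := by
  simp [bracketPow]

theorem bracketPow_mono {r s : ℝ} (h : r ≤ s) (x : Rd d) : bracketPow r x ≤ bracketPow s x :=
  Real.rpow_le_rpow_of_exponent_le (one_le_one_add_norm_sq x) (by linarith)

theorem bracketPow_zero (x : Rd d) : bracketPow 0 x = 1 := by
  simp [bracketPow]

theorem bracketPow_add_le_of_nonneg {r : ℝ} (hr : 0 ≤ r) (x y : Rd d) :
    bracketPow r (x + y) ≤ 2 ^ (r / 2) * bracketPow r x * bracketPow r y := by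
  unfold bracketPow
  rw [← Real.mul_rpow (by positivity) (by positivity),
    ← Real.mul_rpow (by positivity) (by positivity)]
  refine Real.rpow_le_rpow (by positivity) ?_ (by linarith)
  have h1 : ‖x + y‖ ^ 2 ≤ (‖x‖ + ‖y‖) ^ 2 := by
    gcongr
    exact norm_add_le x y
  nlinarith [sq_nonneg (‖x‖ - ‖y‖), mul_nonneg (sq_nonneg ‖x‖) (sq_nonneg ‖y‖)]

theorem bracketPow_add_le (r : ℝ) (x y : Rd d) :
    bracketPow r (x + y) ≤ 2 ^ (|r| / 2) * bracketPow r x * bracketPow |r| y := by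
  rcases le_total 0 r with hr | hr
  · rw [abs_of_nonneg hr]
    exact bracketPow_add_le_of_nonneg hr x y
  · have h := bracketPow_add_le_of_nonneg (abs_nonneg r) (x + y) (-y)
    rw [add_neg_cancel_right, bracketPow_neg_arg] at h
    have hx := bracketPow_neg_mul r x
    have hxy := bracketPow_neg_mul r (x + y)
    rw [← abs_of_nonpos hr] at hx hxy
    have p1 := bracketPow_pos r x
    have p2 := bracketPow_pos r (x + y)
    calc bracketPow r (x + y) = bracketPow |r| x * bracketPow r x * bracketPow r (x + y) := by
          rw [hx, one_mul]
      _ ≤ 2 ^ (|r| / 2) * bracketPow |r| (x + y) * bracketPow |r| y * bracketPow r x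
            * bracketPow r (x + y) := by gcongr
      _ = 2 ^ (|r| / 2) * bracketPow r x * bracketPow |r| y
            * (bracketPow |r| (x + y) * bracketPow r (x + y)) := by ring
      _ = _ := by rw [hxy, mul_one]

theorem one_add_norm_pow_eq_sq_rpow (N : ℕ) (x : Rd d) :
    (1 + ‖x‖) ^ N = ((1 + ‖x‖) ^ 2) ^ ((N : ℝ) / 2) := by
  rw [← Real.rpow_natCast, ← Real.rpow_natCast, ← Real.rpow_mul (by positivity)]
  congr 1
  push_cast
  ring

theorem bracketPow_natCast_le (N : ℕ) (x : Rd d) : bracketPow N x ≤ (1 + ‖x‖) ^ N := by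
  rw [one_add_norm_pow_eq_sq_rpow]
  refine Real.rpow_le_rpow (by positivity) ?_ (by positivity)
  nlinarith [norm_nonneg x]

theorem one_add_norm_pow_le (N : ℕ) (x : Rd d) :
    (1 + ‖x‖) ^ N ≤ 2 ^ ((N : ℝ) / 2) * bracketPow N x := by
  rw [one_add_norm_pow_eq_sq_rpow, bracketPow, ← Real.mul_rpow (by positivity) (by positivity)]
  refine Real.rpow_le_rpow (by positivity) ?_ (by positivity)
  nlinarith [sq_nonneg (1 - ‖x‖)]

theorem le_bracketPow_neg {N : ℕ} {x : Rd d} {a C : ℝ} (ha : 0 ≤ a)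
    (h : (1 + ‖x‖) ^ N * a ≤ C) : a ≤ C * bracketPow (-N) x := by
  have h1 := bracketPow_neg_mul (N : ℝ) x
  have p1 := bracketPow_pos (-N : ℝ) x
  calc a = bracketPow (-N) x * (bracketPow N x * a) := by rw [← mul_assoc, h1, one_mul]
    _ ≤ bracketPow (-N) x * ((1 + ‖x‖) ^ N * a) := by
        gcongr
        exact bracketPow_natCast_le N x
    _ ≤ bracketPow (-N) x * C := by gcongr
    _ = _ := mul_comm _ _

theorem integrable_bracketPow {r : ℝ} (hr : r < -d) :
    Integrable (bracketPow r : Rd d → ℝ) := by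
  have h := integrable_rpow_neg_one_add_norm_sq (E := Rd d) (μ := volume) (r := -r)
    (by rw [finrank_euclideanSpace_fin]; linarith)
  rw [neg_neg] at h
  exact h

theorem integrable_schwartz_mul_bracketPow (φ : 𝓢(Rd d, ℂ)) (r : ℝ) :
    Integrable fun x => ‖φ x‖ * bracketPow r x := by
  obtain ⟨N, hN⟩ := exists_nat_gt (r + d)
  have h := (integrable_bracketPow (d := d) (r := r - N) (by linarith)).const_mul
    (2 ^ N * schwartzNorm N φ)
  have hc : Continuous fun x => ‖φ x‖ * bracketPow r x := by fun_prop
  refine h.mono' hc.aestronglyMeasurable (Eventually.of_forall fun x => ?_)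
  have hr := bracketPow_nonneg r x
  rw [Real.norm_of_nonneg (by positivity)]
  have h1 := le_bracketPow_neg (norm_nonneg _) (one_add_pow_mul_norm_le φ N x)
  calc ‖φ x‖ * bracketPow r x
      ≤ (2 ^ N * schwartzNorm N φ * bracketPow (-N) x) * bracketPow r x := by gcongr
    _ = _ := by rw [sub_eq_add_neg, bracketPow_add]; ring

end Brackets

section Reproducing

variable {d : ℕ}

theorem exists_norm_tfCoeff_le_bracketPow (h : 𝓢(Rd d, ℂ)) (N : ℕ) :
    ∃ (m : ℕ) (C : ℝ), 0 ≤ C ∧ ∀ (φ : 𝓢(Rd d, ℂ)) (x ξ : Rd d),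
      ‖tfCoeff h φ x ξ‖ ≤ C * schwartzNorm m φ * (bracketPow (-N) x * bracketPow (-N) ξ) := by
  obtain ⟨m, C, hC, hb⟩ := exists_norm_tfCoeff_le h N
  refine ⟨m, C, hC, fun φ x ξ => ?_⟩
  have h1 := hb φ x ξ
  rw [mul_assoc] at h1
  have h2 := le_bracketPow_neg (by positivity) h1
  have h3 := le_bracketPow_neg (by positivity) h2
  linarith

theorem integrable_bracketPow_prod {r : ℝ} (hr : r < -d) :
    Integrable fun z : Rd d × Rd d => bracketPow r z.1 * bracketPow r z.2 :=
  (integrable_bracketPow hr).mul_prod (integrable_bracketPow hr)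

theorem exists_schwartzNorm_tfShift_le_bracketPow (γ : 𝓢(Rd d, ℂ)) (m : ℕ) :
    ∃ (N : ℕ) (C : ℝ), 0 ≤ C ∧ ∀ x ξ : Rd d,
      schwartzNorm m (tfShift γ x ξ) ≤ C * (bracketPow N x * bracketPow N ξ) := by
  obtain ⟨N, C, hC, h⟩ := exists_schwartzNorm_tfShift_le γ m
  refine ⟨N, C * 2 ^ ((N : ℝ) / 2) * 2 ^ ((N : ℝ) / 2), by positivity, fun x ξ => ?_⟩
  have p := bracketPow_nonneg (N : ℝ) x
  calc schwartzNorm m (tfShift γ x ξ) ≤ C * (1 + ‖x‖) ^ N * (1 + ‖ξ‖) ^ N := h x ξ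
    _ ≤ C * (2 ^ ((N : ℝ) / 2) * bracketPow N x) * (2 ^ ((N : ℝ) / 2) * bracketPow N ξ) := by
        gcongr
        · exact one_add_norm_pow_le N x
        · exact one_add_norm_pow_le N ξ
    _ = _ := by ring

theorem integrable_schwartzNorm_tfCoeff_smul (h γ φ : 𝓢(Rd d, ℂ)) (m : ℕ) :
    Integrable fun z : Rd d × Rd d =>
      schwartzNorm m (tfCoeff h φ z.1 z.2 • tfShift γ z.1 z.2) := by
  obtain ⟨N, C, -, hN⟩ := exists_schwartzNorm_tfShift_le_bracketPow γ m
  obtain ⟨m', C', hC', hm⟩ := exists_norm_tfCoeff_le_bracketPow h (N + d + 1)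
  refine ((integrable_bracketPow_prod (d := d) (r := -(d + 1)) (by linarith)).const_mul
    (C' * schwartzNorm m' φ * C)).mono' (Continuous.aestronglyMeasurable ?_)
    (Eventually.of_forall fun z => ?_)
  · exact (continuous_schwartzNorm m).comp ((continuous_tfCoeff h φ).smul (continuous_tfShift γ))
  · rw [Real.norm_of_nonneg (apply_nonneg _ _), map_smul_eq_mul]
    have hb (x : Rd d) : bracketPow (-((N + d + 1 : ℕ) : ℝ)) x * bracketPow N x
        = bracketPow (-(d + 1)) x := by
      rw [← bracketPow_add]
      congr 1
      push_cast
      ring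
    have p1 := bracketPow_nonneg (-((N + d + 1 : ℕ) : ℝ)) z.1
    have p2 := bracketPow_nonneg (-((N + d + 1 : ℕ) : ℝ)) z.2
    calc _ ≤ C' * schwartzNorm m' φ * (bracketPow (-((N + d + 1 : ℕ) : ℝ)) z.1
          * bracketPow (-((N + d + 1 : ℕ) : ℝ)) z.2) *
            (C * (bracketPow N z.1 * bracketPow N z.2)) := by
          gcongr
          · exact hm φ z.1 z.2
          · exact hN z.1 z.2
      _ = C' * schwartzNorm m' φ * C *
          ((bracketPow (-((N + d + 1 : ℕ) : ℝ)) z.1 * bracketPow N z.1) *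
          (bracketPow (-((N + d + 1 : ℕ) : ℝ)) z.2 * bracketPow N z.2)) := by ring
      _ = _ := by rw [hb, hb]

theorem continuous_tfCoeff_smul_tfShift (h γ φ : 𝓢(Rd d, ℂ)) :
    Continuous fun z : Rd d × Rd d => tfCoeff h φ z.1 z.2 • tfShift γ z.1 z.2 :=
  (continuous_tfCoeff h φ).smul (continuous_tfShift γ)

variable {E : Type*} [NormedAddCommGroup E] [NormedSpace ℂ E]

theorem integrable_tfCoeff_smul (v : 𝓢(Rd d, ℂ) →L[ℂ] E) (h γ φ : 𝓢(Rd d, ℂ)) :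
    Integrable fun z : Rd d × Rd d => tfCoeff h φ z.1 z.2 • v (tfShift γ z.1 z.2) := by
  have := integrable_clm_comp v (continuous_tfCoeff_smul_tfShift h γ φ)
    (integrable_schwartzNorm_tfCoeff_smul h γ φ)
  simpa only [map_smul] using this

theorem integral_tfCoeff_smul_tfShift_apply (h γ φ : 𝓢(Rd d, ℂ)) (x y : Rd d) :
    ∫ ξ, tfCoeff h φ x ξ • tfShift γ x ξ y = (h (y - x) * γ (y - x)) * φ y := by
  have hinv := fourier_schwartz_apply (𝓕⁻ (mulShift h x φ)) y
  rw [FourierTransform.fourier_fourierInv_eq, mulShift_apply] at hinv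
  calc ∫ ξ, tfCoeff h φ x ξ • tfShift γ x ξ y
      = ∫ ξ, γ (y - x) * (negCharacter y ξ * (𝓕⁻ (mulShift h x φ)) ξ) := by
        congr 1 with ξ
        rw [tfShift_apply, tfCoeff, smul_eq_mul, negCharacter_comm ξ y]
        ring
    _ = (h (y - x) * γ (y - x)) * φ y := by
        rw [integral_const_mul, ← hinv]
        ring

theorem schwartz_apply_eq_integral_tfCoeff_smul {h γ : 𝓢(Rd d, ℂ)} (hγ : ∫ y, h y * γ y = 1)
    (φ : 𝓢(Rd d, ℂ)) (y : Rd d) :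
    φ y = ∫ z : Rd d × Rd d, (tfCoeff h φ z.1 z.2 • tfShift γ z.1 z.2) y := by
  have hint : Integrable fun z : Rd d × Rd d => tfCoeff h φ z.1 z.2 • tfShift γ z.1 z.2 y :=
    integrable_tfCoeff_smul ((BoundedContinuousFunction.evalCLM ℂ y).comp
      (toBoundedContinuousFunctionCLM ℂ (Rd d) ℂ)) h γ φ
  simp only [_root_.smul_apply]
  rw [Measure.volume_eq_prod, integral_prod _ hint]
  simp only [integral_tfCoeff_smul_tfShift_apply]
  rw [integral_mul_const, integral_sub_left_eq_self (fun t => h t * γ t) volume y, hγ, one_mul]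

theorem clm_apply_eq_integral_tfCoeff_smul [CompleteSpace E] (v : 𝓢(Rd d, ℂ) →L[ℂ] E)
    {h γ : 𝓢(Rd d, ℂ)} (hγ : ∫ y, h y * γ y = 1) (φ : 𝓢(Rd d, ℂ)) :
    v φ = ∫ z : Rd d × Rd d, tfCoeff h φ z.1 z.2 • v (tfShift γ z.1 z.2) := by
  simpa only [map_smul] using clm_apply_eq_integral v (continuous_tfCoeff_smul_tfShift h γ φ)
    (integrable_schwartzNorm_tfCoeff_smul h γ φ) (schwartz_apply_eq_integral_tfCoeff_smul hγ φ)

theorem integrable_norm_sq_schwartz (γ : 𝓢(Rd d, ℂ)) : Integrable fun y => ‖γ y‖ ^ 2 := by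
  obtain ⟨C, hC⟩ := exists_norm_le γ
  refine (γ.integrable.norm.const_mul C).mono' (by fun_prop) (Eventually.of_forall fun y => ?_)
  rw [Real.norm_of_nonneg (by positivity), sq]
  exact mul_le_mul_of_nonneg_right (hC y) (norm_nonneg _)

theorem integral_norm_sq_schwartz_ne_zero {γ : 𝓢(Rd d, ℂ)} (hγ : γ ≠ 0) :
    ∫ y, ‖γ y‖ ^ 2 ≠ 0 := by
  contrapose! hγ
  rw [integral_eq_zero_iff_of_nonneg (fun y => by positivity) (integrable_norm_sq_schwartz γ),
    Continuous.ae_eq_iff_eq volume (by fun_prop) continuous_zero] at hγ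
  ext y
  simpa using congrFun hγ y

/-- The complex conjugate of a Schwartz function, itself a Schwartz function. -/
noncomputable def conjSchwartz (g : 𝓢(Rd d, ℂ)) : 𝓢(Rd d, ℂ) :=
  postcompCLM (𝕜 := ℝ) (Complex.conjCLE : ℂ →L[ℝ] ℂ) g

theorem conjSchwartz_apply (g : 𝓢(Rd d, ℂ)) (y : Rd d) :
    conjSchwartz g y = (starRingEnd ℂ) (g y) := by
  simp [conjSchwartz]

theorem exists_dual_window {γ : 𝓢(Rd d, ℂ)} (hγ : γ ≠ 0) :
    ∃ h : 𝓢(Rd d, ℂ), ∫ y, h y * γ y = 1 := by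
  have hconj (y : Rd d) : conjSchwartz γ y * γ y = ((‖γ y‖ ^ 2 : ℝ) : ℂ) := by
    rw [conjSchwartz_apply, mul_comm, Complex.mul_conj, Complex.normSq_eq_norm_sq]
  refine ⟨((∫ y, ‖γ y‖ ^ 2 : ℝ) : ℂ)⁻¹ • conjSchwartz γ, ?_⟩
  simp only [_root_.smul_apply, smul_eq_mul, mul_assoc, hconj]
  rw [integral_const_mul, integral_complex_ofReal, inv_mul_cancel₀]
  exact_mod_cast integral_norm_sq_schwartz_ne_zero hγ

end Reproducing

/-! ### The kernel of the product -/

section Kernel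

variable {d : ℕ}

/-- The weight `⟨x⟩^r ⟨x'⟩^r ⟨ξ + ξ'⟩^r` on pairs of points of phase space. -/
noncomputable def pairWeight (r : ℝ) (p : (Rd d × Rd d) × (Rd d × Rd d)) : ℝ :=
  bracketPow r p.1.1 * bracketPow r p.2.1 * bracketPow r (p.1.2 + p.2.2)

theorem pairWeight_nonneg (r : ℝ) (p : (Rd d × Rd d) × (Rd d × Rd d)) : 0 ≤ pairWeight r p :=
  mul_nonneg (mul_nonneg (bracketPow_nonneg _ _) (bracketPow_nonneg _ _)) (bracketPow_nonneg _ _)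

/-- The kernel `∫ φ (y) h₀ (y - x) h₁ (y - x') exp (2πi y·(ξ + ξ')) dy` through which products
act on pairs of short-time Fourier transforms. -/
noncomputable def productKernel (h₀ h₁ φ : 𝓢(Rd d, ℂ)) (p : (Rd d × Rd d) × (Rd d × Rd d)) : ℂ :=
  tfCoeff h₀ (mulShift h₁ p.2.1 φ) p.1.1 (p.1.2 + p.2.2)

@[fun_prop]
theorem continuous_productKernel (h₀ h₁ φ : 𝓢(Rd d, ℂ)) : Continuous (productKernel h₀ h₁ φ) := by
  have h : Continuous fun p : (Rd d × Rd d) × (Rd d × Rd d) =>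
      ((p.1.1, p.2.1, p.1.2 + p.2.2) : Rd d × Rd d × Rd d) := by fun_prop
  unfold productKernel
  simpa only [Function.comp_def] using (continuous_tfCoeff_mulShift h₀ h₁ φ).comp h

theorem productKernel_eq (h₀ h₁ φ : 𝓢(Rd d, ℂ)) (x ξ x' ξ' : Rd d) :
    productKernel h₀ h₁ φ ((x, ξ), (x', ξ'))
      = ∫ y, (negCharacter (-ξ) y * h₀ (y - x)) * ((negCharacter (-ξ') y * h₁ (y - x')) * φ y) := by
  rw [productKernel, tfCoeff_eq]
  congr 1 with y
  rw [mulShift_apply, neg_add, negCharacter_add_left]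
  ring

theorem norm_productKernel_tfShift (h₀ h₁ γ : 𝓢(Rd d, ℂ)) (x ξ : Rd d)
    (a : (Rd d × Rd d) × (Rd d × Rd d)) :
    ‖productKernel h₀ h₁ (tfShift γ x ξ) (((x, 0), (x, ξ)) + a)‖ = ‖productKernel h₀ h₁ γ a‖ := by
  rw [productKernel, mulShift_tfShift, norm_tfCoeff_tfShift, productKernel]
  congr 2
  · simp
  · simp
  · simp only [Prod.fst_add, Prod.snd_add]
    abel

theorem exists_norm_tfCoeff_mulShift_le (h₀ h₁ : 𝓢(Rd d, ℂ)) (N : ℕ) :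
    ∃ (m : ℕ) (C : ℝ), 0 ≤ C ∧ ∀ (φ : 𝓢(Rd d, ℂ)) (x x' ω : Rd d),
      ‖tfCoeff h₀ (mulShift h₁ x' φ) x ω‖ ≤ C * schwartzNorm m φ *
        (bracketPow (-N) x * bracketPow (-N) x' * bracketPow (-N) ω) := by
  obtain ⟨m, C, hC, h⟩ := exists_norm_tfCoeff_le_bracketPow h₀ N
  obtain ⟨C', hC', h'⟩ := exists_schwartzNorm_mulShift_le h₁ m N
  refine ⟨m + N, C * C', by positivity, fun φ x x' ω => ?_⟩
  have hx' := le_bracketPow_neg (apply_nonneg _ _) (h' x' φ)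
  have hx₀ := bracketPow_nonneg (-(N : ℝ)) x
  have hω₀ := bracketPow_nonneg (-(N : ℝ)) ω
  calc _ ≤ C * schwartzNorm m (mulShift h₁ x' φ) * (bracketPow (-N) x * bracketPow (-N) ω) :=
        h _ x ω
    _ ≤ C * (C' * schwartzNorm (m + N) φ * bracketPow (-N) x')
          * (bracketPow (-N) x * bracketPow (-N) ω) := by gcongr
    _ = _ := by ring

theorem exists_norm_productKernel_le (h₀ h₁ : 𝓢(Rd d, ℂ)) (N : ℕ) :
    ∃ (m : ℕ) (C : ℝ), 0 ≤ C ∧ ∀ (φ : 𝓢(Rd d, ℂ)) p,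
      ‖productKernel h₀ h₁ φ p‖ ≤ C * schwartzNorm m φ * pairWeight (-N) p := by
  obtain ⟨m, C, hC, h⟩ := exists_norm_tfCoeff_mulShift_le h₀ h₁ N
  exact ⟨m, C, hC, fun φ p => h φ p.1.1 p.2.1 (p.1.2 + p.2.2)⟩

end Kernel

section Mollification

variable {d : ℕ}

theorem reflDilate_eq_tfShift (ρ : 𝓢(Rd d, ℂ)) {ε : ℝ} (hε : ε ≠ 0) (y : Rd d) :
    reflDilate ρ ε y = tfShift (reflDilate ρ ε 0) y 0 := by
  ext t
  rw [tfShift_zero_right, compSubConstCLM_apply, reflDilate_apply ρ hε, reflDilate_apply ρ hε]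
  simp

theorem tfCoeff_tfShift_zero (h γ : 𝓢(Rd d, ℂ)) (x₀ x ξ : Rd d) :
    tfCoeff h (tfShift γ x₀ 0) x ξ = negCharacter (-x₀) ξ * tfCoeff h γ (x - x₀) ξ := by
  rw [tfCoeff, mulShift_tfShift, fourierInv_tfShift]
  simp [tfShift_apply, tfCoeff]

theorem tfCoeff_reflDilate_eq_mul (h ρ : 𝓢(Rd d, ℂ)) {ε : ℝ} (hε : ε ≠ 0) (y x ξ : Rd d) :
    tfCoeff h (reflDilate ρ ε y) x ξ
      = negCharacter (-y) ξ * tfCoeff h (reflDilate ρ ε 0) (x - y) ξ := by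
  rw [reflDilate_eq_tfShift ρ hε y, tfCoeff_tfShift_zero]

theorem continuous_tfCoeff_reflDilate (h ρ : 𝓢(Rd d, ℂ)) {ε : ℝ} (hε : ε ≠ 0) :
    Continuous fun p : Rd d × (Rd d × Rd d) =>
      tfCoeff h (reflDilate ρ ε p.1) p.2.1 p.2.2 := by
  have hcoeff : Continuous fun p : Rd d × (Rd d × Rd d) =>
      tfCoeff h (reflDilate ρ ε 0) (p.2.1 - p.1) p.2.2 :=
    (continuous_tfCoeff h (reflDilate ρ ε 0)).comp
      (by fun_prop : Continuous fun p : Rd d × (Rd d × Rd d) => (p.2.1 - p.1, p.2.2))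
  refine (Continuous.mul (by fun_prop) hcoeff).congr fun p =>
    (tfCoeff_reflDilate_eq_mul h ρ hε p.1 p.2.1 p.2.2).symm

theorem exists_norm_tfCoeff_reflDilate_le (h ρ : 𝓢(Rd d, ℂ)) {ε : ℝ} (hε : ε ≠ 0) (N : ℕ) :
    ∃ C : ℝ, 0 ≤ C ∧ ∀ y x ξ : Rd d, ‖tfCoeff h (reflDilate ρ ε y) x ξ‖ ≤
      C * (bracketPow N y * (bracketPow (-N) x * bracketPow (-N) ξ)) := by
  obtain ⟨m, C, hC, hb⟩ := exists_norm_tfCoeff_le_bracketPow h N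
  refine ⟨C * schwartzNorm m (reflDilate ρ ε 0) * 2 ^ ((N : ℝ) / 2), by positivity,
    fun y x ξ => ?_⟩
  rw [tfCoeff_reflDilate_eq_mul h ρ hε, norm_mul, norm_negCharacter, one_mul]
  have hpeetre := bracketPow_add_le (-(N : ℝ)) x (-y)
  rw [abs_neg, abs_of_nonneg (Nat.cast_nonneg N), bracketPow_neg_arg, ← sub_eq_add_neg] at hpeetre
  have hξ := bracketPow_nonneg (-(N : ℝ)) ξ
  calc _ ≤ C * schwartzNorm m (reflDilate ρ ε 0) *
          (bracketPow (-N) (x - y) * bracketPow (-N) ξ) := hb _ _ _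
    _ ≤ C * schwartzNorm m (reflDilate ρ ε 0) *
          ((2 ^ ((N : ℝ) / 2) * bracketPow (-N) x * bracketPow N y) * bracketPow (-N) ξ) := by
        gcongr
    _ = _ := by ring

theorem integral_comp_sub_smul {F : Type*} [NormedAddCommGroup F] [NormedSpace ℝ F]
    (G : Rd d → F) {ε : ℝ} (hε : 0 < ε) (y : Rd d) :
    ∫ t, G t = ε ^ d • ∫ τ, G (y - ε • τ) := by
  have h := Measure.integral_comp_smul (volume : Measure (Rd d)) (fun s => G (y - s)) ε
  rw [integral_sub_left_eq_self G volume y, finrank_euclideanSpace_fin,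
    abs_of_pos (by positivity)] at h
  rw [h, smul_inv_smul₀ (by positivity)]

theorem tfCoeff_reflDilate_eq (h ρ : 𝓢(Rd d, ℂ)) {ε : ℝ} (hε : 0 < ε) (y x ξ : Rd d) :
    tfCoeff h (reflDilate ρ ε y) x ξ
      = ∫ τ, ρ τ * (negCharacter (-ξ) (y - ε • τ) * h (y - ε • τ - x)) := by
  rw [tfCoeff_eq, integral_comp_sub_smul _ hε y, ← integral_smul]
  congr 1 with τ
  have hε' : ((ε ^ d : ℝ) : ℂ) ≠ 0 := by exact_mod_cast (pow_pos hε d).ne'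
  rw [reflDilate_apply ρ hε.ne', sub_sub_cancel, smul_smul, inv_mul_cancel₀ hε.ne', one_smul,
    Complex.ofReal_inv, Complex.real_smul]
  field_simp

/-- The coefficient with which a pair of short-time Fourier transforms enters the integral of `φ`
against the product of two regularizations at scale `ε`. -/
noncomputable def mollifiedKernel (h₀ h₁ ρ σ φ : 𝓢(Rd d, ℂ)) (ε : ℝ)
    (p : (Rd d × Rd d) × (Rd d × Rd d)) : ℂ :=
  ∫ y, φ y * (tfCoeff h₀ (reflDilate ρ ε y) p.1.1 p.1.2 *
    tfCoeff h₁ (reflDilate σ ε y) p.2.1 p.2.2)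

theorem integrable_mollifiedKernel_integrand (h₀ h₁ ρ σ φ : 𝓢(Rd d, ℂ)) (ε : ℝ)
    (x ξ x' ξ' : Rd d) :
    Integrable fun q : Rd d × (Rd d × Rd d) => φ q.1 *
      ((ρ q.2.1 * (negCharacter (-ξ) (q.1 - ε • q.2.1) * h₀ (q.1 - ε • q.2.1 - x))) *
        (σ q.2.2 * (negCharacter (-ξ') (q.1 - ε • q.2.2) * h₁ (q.1 - ε • q.2.2 - x')))) := by
  obtain ⟨C₀, hh₀⟩ := exists_norm_le h₀
  obtain ⟨C₁, hh₁⟩ := exists_norm_le h₁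
  have hC₀ := (norm_nonneg _).trans (hh₀ 0)
  refine (φ.integrable.norm.mul_prod ((ρ.integrable.norm.mul_const C₀).mul_prod
    (σ.integrable.norm.mul_const C₁))).mono' (by fun_prop) (Eventually.of_forall fun q => ?_)
  simp only [norm_mul, norm_negCharacter, one_mul]
  gcongr
  · exact hh₀ _
  · exact hh₁ _

/-- The integrand of `mollifiedKernel` as an average of `productKernel` over the points of the two
mollifiers, see `mollifiedKernel_eq`. -/
noncomputable def shiftedKernel (h₀ h₁ ρ σ φ : 𝓢(Rd d, ℂ)) (p : (Rd d × Rd d) × (Rd d × Rd d))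
    (ε : ℝ) (t : Rd d × Rd d) : ℂ :=
  (ρ t.1 * σ t.2) * ((negCharacter (-p.1.2) (-(ε • t.1)) * negCharacter (-p.2.2) (-(ε • t.2))) *
    productKernel h₀ h₁ φ ((p.1.1 + ε • t.1, p.1.2), (p.2.1 + ε • t.2, p.2.2)))

theorem continuous_shiftedKernel (h₀ h₁ ρ σ φ : 𝓢(Rd d, ℂ))
    (p : (Rd d × Rd d) × (Rd d × Rd d)) :
    Continuous fun q : ℝ × (Rd d × Rd d) => shiftedKernel h₀ h₁ ρ σ φ p q.1 q.2 := by
  unfold shiftedKernel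
  fun_prop

theorem norm_shiftedKernel (h₀ h₁ ρ σ φ : 𝓢(Rd d, ℂ)) (p : (Rd d × Rd d) × (Rd d × Rd d))
    (ε : ℝ) (t : Rd d × Rd d) :
    ‖shiftedKernel h₀ h₁ ρ σ φ p ε t‖ = ‖ρ t.1‖ * ‖σ t.2‖ *
      ‖productKernel h₀ h₁ φ ((p.1.1 + ε • t.1, p.1.2), (p.2.1 + ε • t.2, p.2.2))‖ := by
  simp only [shiftedKernel, norm_mul, norm_negCharacter, one_mul]

theorem mollifiedKernel_eq (h₀ h₁ ρ σ φ : 𝓢(Rd d, ℂ)) {ε : ℝ} (hε : 0 < ε)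
    (p : (Rd d × Rd d) × (Rd d × Rd d)) :
    mollifiedKernel h₀ h₁ ρ σ φ ε p = ∫ t, shiftedKernel h₀ h₁ ρ σ φ p ε t := by
  obtain ⟨⟨x, ξ⟩, ⟨x', ξ'⟩⟩ := p
  let f (y : Rd d) (t : Rd d × Rd d) : ℂ := φ y *
    ((ρ t.1 * (negCharacter (-ξ) (y - ε • t.1) * h₀ (y - ε • t.1 - x))) *
      (σ t.2 * (negCharacter (-ξ') (y - ε • t.2) * h₁ (y - ε • t.2 - x'))))
  have hf (t : Rd d × Rd d) :
      ∫ y, f y t = shiftedKernel h₀ h₁ ρ σ φ ((x, ξ), (x', ξ')) ε t := by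
    rw [shiftedKernel, productKernel_eq, ← integral_const_mul, ← integral_const_mul]
    congr 1 with y
    simp only [f, sub_eq_add_neg, negCharacter_add_right, neg_add, add_assoc,
      add_comm (-(ε • t.1)) (-x), add_comm (-(ε • t.2)) (-x')]
    ring
  calc mollifiedKernel h₀ h₁ ρ σ φ ε ((x, ξ), (x', ξ')) = ∫ y, ∫ t, f y t := by
        unfold mollifiedKernel
        congr 1 with y
        rw [integral_const_mul, tfCoeff_reflDilate_eq h₀ ρ hε, tfCoeff_reflDilate_eq h₁ σ hε]
        exact congrArg _ (integral_prod_mul _ _).symm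
    _ = ∫ t, ∫ y, f y t :=
        integral_integral_swap (integrable_mollifiedKernel_integrand h₀ h₁ ρ σ φ ε x ξ x' ξ')
    _ = ∫ t, shiftedKernel h₀ h₁ ρ σ φ ((x, ξ), (x', ξ')) ε t := by simp only [hf]

theorem bracketPow_add_smul_le (N : ℕ) (x τ : Rd d) {ε : ℝ} (hε : |ε| ≤ 1) :
    bracketPow (-N) (x + ε • τ) ≤ 2 ^ ((N : ℝ) / 2) * bracketPow (-N) x * bracketPow N τ := by
  have hpeetre := bracketPow_add_le (-(N : ℝ)) x (ε • τ)
  rw [abs_neg, abs_of_nonneg (Nat.cast_nonneg N)] at hpeetre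
  have hτ : ‖ε • τ‖ ≤ ‖τ‖ := by
    rw [norm_smul]
    exact mul_le_of_le_one_left (norm_nonneg _) hε
  refine hpeetre.trans (mul_le_mul_of_nonneg_left (Real.rpow_le_rpow (by positivity) ?_
    (by positivity)) (mul_nonneg (by positivity) (bracketPow_nonneg _ _)))
  gcongr

theorem pairWeight_add_smul_le (N : ℕ) (p : (Rd d × Rd d) × (Rd d × Rd d)) {ε : ℝ}
    (hε : |ε| ≤ 1) (t : Rd d × Rd d) :
    pairWeight (-N) ((p.1.1 + ε • t.1, p.1.2), (p.2.1 + ε • t.2, p.2.2)) ≤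
      (2 ^ ((N : ℝ) / 2)) ^ 2 * pairWeight (-N) p * (bracketPow N t.1 * bracketPow N t.2) := by
  have hω := bracketPow_nonneg (-(N : ℝ)) (p.1.2 + p.2.2)
  have hx := (bracketPow_nonneg _ _).trans (bracketPow_add_smul_le N p.1.1 t.1 hε)
  calc bracketPow (-N) (p.1.1 + ε • t.1) * bracketPow (-N) (p.2.1 + ε • t.2)
        * bracketPow (-N) (p.1.2 + p.2.2)
      ≤ (2 ^ ((N : ℝ) / 2) * bracketPow (-N) p.1.1 * bracketPow N t.1)
        * (2 ^ ((N : ℝ) / 2) * bracketPow (-N) p.2.1 * bracketPow N t.2)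
        * bracketPow (-N) (p.1.2 + p.2.2) := by
        refine mul_le_mul_of_nonneg_right (mul_le_mul ?_ ?_ (bracketPow_nonneg _ _) hx) hω
        · exact bracketPow_add_smul_le N p.1.1 t.1 hε
        · exact bracketPow_add_smul_le N p.2.1 t.2 hε
    _ = _ := by
        simp only [pairWeight]
        ring

theorem exists_norm_mollifiedKernel_le (h₀ h₁ ρ σ φ : 𝓢(Rd d, ℂ)) (N : ℕ) :
    ∃ C : ℝ, ∀ ε, 0 < ε → ε ≤ 1 → ∀ p,
      ‖mollifiedKernel h₀ h₁ ρ σ φ ε p‖ ≤ C * pairWeight (-N) p := by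
  obtain ⟨m, C, hC, hb⟩ := exists_norm_productKernel_le h₀ h₁ N
  let K : ℝ := C * schwartzNorm m φ * (2 ^ ((N : ℝ) / 2)) ^ 2
  let M (t : Rd d × Rd d) : ℝ := (‖ρ t.1‖ * bracketPow N t.1) * (‖σ t.2‖ * bracketPow N t.2)
  have hM : Integrable M := (integrable_schwartz_mul_bracketPow ρ N).mul_prod
    (integrable_schwartz_mul_bracketPow σ N)
  refine ⟨K * ∫ t, M t, fun ε hε hε' p => ?_⟩
  rw [mollifiedKernel_eq h₀ h₁ ρ σ φ hε]
  calc ‖∫ t, shiftedKernel h₀ h₁ ρ σ φ p ε t‖ ≤ ∫ t, K * pairWeight (-N) p * M t := by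
        refine norm_integral_le_of_norm_le (hM.const_mul _) (Eventually.of_forall fun t => ?_)
        have hshift := pairWeight_add_smul_le N p ((abs_of_pos hε).trans_le hε') t
        rw [norm_shiftedKernel]
        calc _ ≤ ‖ρ t.1‖ * ‖σ t.2‖ * (C * schwartzNorm m φ * ((2 ^ ((N : ℝ) / 2)) ^ 2 *
              pairWeight (-N) p * (bracketPow N t.1 * bracketPow N t.2))) := by
              gcongr
              exact (hb φ _).trans (by gcongr)
          _ = K * pairWeight (-N) p * M t := by
              simp only [K, M]
              ring
    _ = (K * ∫ t, M t) * pairWeight (-N) p := by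
        rw [integral_const_mul]
        ring

theorem tendsto_integral_shiftedKernel (h₀ h₁ ρ σ φ : 𝓢(Rd d, ℂ))
    (p : (Rd d × Rd d) × (Rd d × Rd d)) :
    Tendsto (fun ε => ∫ t, shiftedKernel h₀ h₁ ρ σ φ p ε t) (𝓝 0)
      (𝓝 (∫ t, shiftedKernel h₀ h₁ ρ σ φ p 0 t)) := by
  obtain ⟨m, C, -, hb⟩ := exists_norm_productKernel_le h₀ h₁ 0
  refine tendsto_integral_filter_of_dominated_convergence
    (fun t => (‖ρ t.1‖ * ‖σ t.2‖) * (C * schwartzNorm m φ)) (Eventually.of_forall fun ε => ?_)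
    (Eventually.of_forall fun ε => Eventually.of_forall fun t => ?_)
    ((ρ.integrable.norm.mul_prod σ.integrable.norm).mul_const _)
    (Eventually.of_forall fun t => ?_)
  · exact ((continuous_shiftedKernel h₀ h₁ ρ σ φ p).comp
      (Continuous.prodMk_right ε)).aestronglyMeasurable
  · rw [norm_shiftedKernel]
    gcongr
    simpa [pairWeight, bracketPow_zero] using
      hb φ ((p.1.1 + ε • t.1, p.1.2), (p.2.1 + ε • t.2, p.2.2))
  · exact ((continuous_shiftedKernel h₀ h₁ ρ σ φ p).comp (Continuous.prodMk_left t)).tendsto 0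

theorem tendsto_mollifiedKernel (h₀ h₁ φ : 𝓢(Rd d, ℂ)) {ρ σ : 𝓢(Rd d, ℂ)} (hρ : ∫ x, ρ x = 1)
    (hσ : ∫ x, σ x = 1) (p : (Rd d × Rd d) × (Rd d × Rd d)) :
    Tendsto (fun ε => mollifiedKernel h₀ h₁ ρ σ φ ε p) (𝓝[>] 0)
      (𝓝 (productKernel h₀ h₁ φ p)) := by
  have hlimit : ∫ t, shiftedKernel h₀ h₁ ρ σ φ p 0 t = productKernel h₀ h₁ φ p := by
    simp only [shiftedKernel, zero_smul, neg_zero, add_zero, negCharacter_comm _ (0 : Rd d),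
      negCharacter_zero_left, one_mul]
    rw [integral_mul_const, Measure.volume_eq_prod, integral_prod_mul, hρ, hσ, one_mul, one_mul]
  rw [← hlimit]
  refine ((tendsto_integral_shiftedKernel h₀ h₁ ρ σ φ p).mono_left nhdsWithin_le_nhds).congr' ?_
  filter_upwards [self_mem_nhdsWithin] with ε hε
  exact (mollifiedKernel_eq h₀ h₁ ρ σ φ hε p).symm

end Mollification

section Products

variable {d : ℕ} {E E₀ E₁ E₂ : Type*}
  [NormedAddCommGroup E] [NormedSpace ℂ E]
  [NormedAddCommGroup E₀] [NormedSpace ℂ E₀] [NormedAddCommGroup E₁] [NormedSpace ℂ E₁]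
  [NormedAddCommGroup E₂] [NormedSpace ℂ E₂]

/-- The short-time Fourier transform of `v` with respect to `tfShift`, which unlike `stft` does not
conjugate the window. -/
noncomputable def clmSTFT (γ : 𝓢(Rd d, ℂ)) (v : 𝓢(Rd d, ℂ) →L[ℂ] E) (z : Rd d × Rd d) : E :=
  v (tfShift γ z.1 z.2)

theorem continuous_clmSTFT (γ : 𝓢(Rd d, ℂ)) (v : 𝓢(Rd d, ℂ) →L[ℂ] E) :
    Continuous (clmSTFT γ v) :=
  v.continuous.comp (continuous_tfShift γ)

theorem exists_integrable_clmSTFT (γ : 𝓢(Rd d, ℂ)) (v : 𝓢(Rd d, ℂ) →L[ℂ] E) :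
    ∃ M : ℕ, ∀ N : ℕ, M ≤ N → Integrable fun z : Rd d × Rd d =>
      bracketPow (-N) z.1 * bracketPow (-N) z.2 * ‖clmSTFT γ v z‖ := by
  obtain ⟨m, C, hC, hv⟩ := exists_norm_le_schwartzNorm v
  obtain ⟨M, C', -, hM⟩ := exists_schwartzNorm_tfShift_le_bracketPow γ m
  refine ⟨M + d + 1, fun N hN => ?_⟩
  have hN' : (M : ℝ) + d + 1 ≤ N := by exact_mod_cast hN
  have hcont := continuous_clmSTFT γ v
  refine ((integrable_bracketPow_prod (d := d) (r := M - N) (by linarith)).const_mul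
    (C * C')).mono' (Continuous.aestronglyMeasurable (by fun_prop))
    (Eventually.of_forall fun z => ?_)
  have hx := bracketPow_nonneg (-(N : ℝ)) z.1
  have hξ := bracketPow_nonneg (-(N : ℝ)) z.2
  rw [Real.norm_of_nonneg (by positivity)]
  calc _ ≤ bracketPow (-N) z.1 * bracketPow (-N) z.2 *
        (C * (C' * (bracketPow M z.1 * bracketPow M z.2))) := by
        gcongr
        exact (hv _).trans (by gcongr; exact hM _ _)
    _ = _ := by
        rw [sub_eq_add_neg, bracketPow_add, bracketPow_add]
        ring

variable (B : E₀ →L[ℂ] E₁ →L[ℂ] E₂) (u : 𝓢(Rd d, ℂ) →L[ℂ] E₀) (v : 𝓢(Rd d, ℂ) →L[ℂ] E₁)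
  {γ₀ γ₁ h₀ h₁ : 𝓢(Rd d, ℂ)}

/-- The pairing through `B` of two short-time Fourier transforms. -/
noncomputable def pairSTFT (γ₀ γ₁ : 𝓢(Rd d, ℂ)) (p : (Rd d × Rd d) × (Rd d × Rd d)) : E₂ :=
  B (clmSTFT γ₀ u p.1) (clmSTFT γ₁ v p.2)

@[fun_prop]
theorem continuous_pairSTFT (γ₀ γ₁ : 𝓢(Rd d, ℂ)) : Continuous (pairSTFT B u v γ₀ γ₁) := by
  have hu := continuous_clmSTFT γ₀ u
  have hv := continuous_clmSTFT γ₁ v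
  unfold pairSTFT
  fun_prop

theorem norm_pairSTFT_le (γ₀ γ₁ : 𝓢(Rd d, ℂ)) (p : (Rd d × Rd d) × (Rd d × Rd d)) :
    ‖pairSTFT B u v γ₀ γ₁ p‖ ≤ ‖B‖ * (‖clmSTFT γ₀ u p.1‖ * ‖clmSTFT γ₁ v p.2‖) :=
  (B.le_opNorm₂ _ _).trans_eq (mul_assoc _ _ _)

theorem integrable_tfCoeff_mul_tfCoeff_smul_pairSTFT (h₀ h₁ γ₀ γ₁ φ ψ : 𝓢(Rd d, ℂ)) :
    Integrable fun p : (Rd d × Rd d) × (Rd d × Rd d) =>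
      (tfCoeff h₀ φ p.1.1 p.1.2 * tfCoeff h₁ ψ p.2.1 p.2.2) • pairSTFT B u v γ₀ γ₁ p := by
  have hφ := (continuous_tfCoeff h₀ φ).comp (continuous_fst (Y := Rd d × Rd d))
  have hψ := (continuous_tfCoeff h₁ ψ).comp (continuous_snd (X := Rd d × Rd d))
  refine (((integrable_tfCoeff_smul u h₀ γ₀ φ).norm.mul_prod
    (integrable_tfCoeff_smul v h₁ γ₁ ψ).norm).const_mul ‖B‖).mono'
    ((hφ.mul hψ).smul (continuous_pairSTFT B u v γ₀ γ₁)).aestronglyMeasurable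
    (Eventually.of_forall fun p => ?_)
  rw [norm_smul, norm_mul, norm_smul, norm_smul]
  calc _ ≤ ‖tfCoeff h₀ φ p.1.1 p.1.2‖ * ‖tfCoeff h₁ ψ p.2.1 p.2.2‖ *
        (‖B‖ * (‖clmSTFT γ₀ u p.1‖ * ‖clmSTFT γ₁ v p.2‖)) := by
        gcongr
        exact norm_pairSTFT_le B u v γ₀ γ₁ p
    _ = _ := by
        rw [clmSTFT, clmSTFT]
        ring

theorem continuous_mollifiedKernel_integrand (h₀ h₁ ρ σ φ : 𝓢(Rd d, ℂ)) {ε : ℝ} (hε : ε ≠ 0) :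
    Continuous fun q : Rd d × ((Rd d × Rd d) × (Rd d × Rd d)) =>
      φ q.1 * (tfCoeff h₀ (reflDilate ρ ε q.1) q.2.1.1 q.2.1.2 *
        tfCoeff h₁ (reflDilate σ ε q.1) q.2.2.1 q.2.2.2) := by
  have hρ := (continuous_tfCoeff_reflDilate h₀ ρ hε).comp
    (by fun_prop : Continuous fun q : Rd d × ((Rd d × Rd d) × (Rd d × Rd d)) => (q.1, q.2.1))
  have hσ := (continuous_tfCoeff_reflDilate h₁ σ hε).comp
    (by fun_prop : Continuous fun q : Rd d × ((Rd d × Rd d) × (Rd d × Rd d)) => (q.1, q.2.2))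
  simpa only [Function.comp_def, Pi.mul_def] using
    (φ.continuous.comp continuous_fst).mul (hρ.mul hσ)

theorem stronglyMeasurable_mollifiedKernel (h₀ h₁ ρ σ φ : 𝓢(Rd d, ℂ)) {ε : ℝ} (hε : ε ≠ 0) :
    StronglyMeasurable (mollifiedKernel h₀ h₁ ρ σ φ ε) :=
  (continuous_mollifiedKernel_integrand h₀ h₁ ρ σ φ
    hε).stronglyMeasurable.integral_prod_left (μ := volume)

theorem integrable_mollifiedKernel_integrand_smul_pairSTFT (h₀ h₁ γ₀ γ₁ ρ σ φ : 𝓢(Rd d, ℂ))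
    {ε : ℝ} (hε : ε ≠ 0) :
    Integrable fun q : Rd d × ((Rd d × Rd d) × (Rd d × Rd d)) =>
      (φ q.1 * (tfCoeff h₀ (reflDilate ρ ε q.1) q.2.1.1 q.2.1.2 *
        tfCoeff h₁ (reflDilate σ ε q.1) q.2.2.1 q.2.2.2)) • pairSTFT B u v γ₀ γ₁ q.2 := by
  obtain ⟨M₀, hM₀⟩ := exists_integrable_clmSTFT γ₀ u
  obtain ⟨M₁, hM₁⟩ := exists_integrable_clmSTFT γ₁ v
  let N := max M₀ M₁
  obtain ⟨C₀, hC₀, hρ⟩ := exists_norm_tfCoeff_reflDilate_le h₀ ρ hε N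
  obtain ⟨C₁, hC₁, hσ⟩ := exists_norm_tfCoeff_reflDilate_le h₁ σ hε N
  refine (((integrable_schwartz_mul_bracketPow φ (N + N)).mul_prod
    ((hM₀ N (le_max_left _ _)).mul_prod (hM₁ N (le_max_right _ _)))).const_mul
      (C₀ * C₁ * ‖B‖)).mono' ?_ (Eventually.of_forall fun q => ?_)
  · exact ((continuous_mollifiedKernel_integrand h₀ h₁ ρ σ φ hε).smul
      ((continuous_pairSTFT B u v γ₀ γ₁).comp continuous_snd)).aestronglyMeasurable
  · rw [norm_smul, norm_mul, norm_mul]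
    have hx := bracketPow_nonneg (-(N : ℝ)) q.2.1.1
    have hξ := bracketPow_nonneg (-(N : ℝ)) q.2.1.2
    have hx' := bracketPow_nonneg (-(N : ℝ)) q.2.2.1
    have hξ' := bracketPow_nonneg (-(N : ℝ)) q.2.2.2
    have hy := bracketPow_nonneg (N : ℝ) q.1
    calc _ ≤ ‖φ q.1‖ *
          ((C₀ * (bracketPow N q.1 * (bracketPow (-N) q.2.1.1 * bracketPow (-N) q.2.1.2))) *
          (C₁ * (bracketPow N q.1 * (bracketPow (-N) q.2.2.1 * bracketPow (-N) q.2.2.2)))) *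
          (‖B‖ * (‖clmSTFT γ₀ u q.2.1‖ * ‖clmSTFT γ₁ v q.2.2‖)) := by
          gcongr
          · exact hρ _ _ _
          · exact hσ _ _ _
          · exact norm_pairSTFT_le B u v γ₀ γ₁ _
      _ = _ := by
          rw [bracketPow_add]
          ring

section Reproducing

variable [CompleteSpace E₂]

theorem clm_apply_clm_apply_eq_integral (hγ₀ : ∫ y, h₀ y * γ₀ y = 1)
    (hγ₁ : ∫ y, h₁ y * γ₁ y = 1) (φ ψ : 𝓢(Rd d, ℂ)) :
    B (u φ) (v ψ) = ∫ p : (Rd d × Rd d) × (Rd d × Rd d),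
      (tfCoeff h₀ φ p.1.1 p.1.2 * tfCoeff h₁ ψ p.2.1 p.2.2) • pairSTFT B u v γ₀ γ₁ p := by
  have hint := integrable_tfCoeff_mul_tfCoeff_smul_pairSTFT B u v h₀ h₁ γ₀ γ₁ φ ψ
  have hu := clm_apply_eq_integral_tfCoeff_smul ((B.flip (v ψ)).comp u) hγ₀ φ
  have hv (z : Rd d × Rd d) := clm_apply_eq_integral_tfCoeff_smul
    ((B (clmSTFT γ₀ u z)).comp v) hγ₁ ψ
  calc B (u φ) (v ψ)
      = ∫ z : Rd d × Rd d, tfCoeff h₀ φ z.1 z.2 • B (clmSTFT γ₀ u z) (v ψ) := hu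
    _ = ∫ z : Rd d × Rd d, ∫ z' : Rd d × Rd d,
          (tfCoeff h₀ φ z.1 z.2 * tfCoeff h₁ ψ z'.1 z'.2) • pairSTFT B u v γ₀ γ₁ (z, z') := by
        congr 1 with z
        simp only [mul_smul]
        rw [integral_smul]
        exact congrArg _ (hv z)
    _ = _ := (integral_prod _ hint).symm

theorem smul_regularized_product_eq_integral (hγ₀ : ∫ y, h₀ y * γ₀ y = 1)
    (hγ₁ : ∫ y, h₁ y * γ₁ y = 1) (ρ σ φ : 𝓢(Rd d, ℂ)) (ε : ℝ) (y : Rd d) :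
    φ y • B (u (reflDilate ρ ε y)) (v (reflDilate σ ε y))
      = ∫ p : (Rd d × Rd d) × (Rd d × Rd d),
        (φ y * (tfCoeff h₀ (reflDilate ρ ε y) p.1.1 p.1.2 *
          tfCoeff h₁ (reflDilate σ ε y) p.2.1 p.2.2)) • pairSTFT B u v γ₀ γ₁ p := by
  simp only [mul_smul (φ y)]
  rw [integral_smul, clm_apply_clm_apply_eq_integral B u v hγ₀ hγ₁]

theorem integrable_smul_regularized_product (hγ₀ : ∫ y, h₀ y * γ₀ y = 1)
    (hγ₁ : ∫ y, h₁ y * γ₁ y = 1) (ρ σ φ : 𝓢(Rd d, ℂ)) {ε : ℝ} (hε : ε ≠ 0) :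
    Integrable fun y => φ y • B (u (reflDilate ρ ε y)) (v (reflDilate σ ε y)) := by
  simp only [smul_regularized_product_eq_integral B u v hγ₀ hγ₁]
  exact (integrable_mollifiedKernel_integrand_smul_pairSTFT B u v h₀ h₁ γ₀ γ₁ ρ σ φ
    hε).integral_prod_left

theorem integral_smul_regularized_product (hγ₀ : ∫ y, h₀ y * γ₀ y = 1)
    (hγ₁ : ∫ y, h₁ y * γ₁ y = 1) (ρ σ φ : 𝓢(Rd d, ℂ)) {ε : ℝ} (hε : ε ≠ 0) :
    ∫ y, φ y • B (u (reflDilate ρ ε y)) (v (reflDilate σ ε y))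
      = ∫ p, mollifiedKernel h₀ h₁ ρ σ φ ε p • pairSTFT B u v γ₀ γ₁ p := by
  simp only [smul_regularized_product_eq_integral B u v hγ₀ hγ₁]
  rw [integral_integral_swap
    (integrable_mollifiedKernel_integrand_smul_pairSTFT B u v h₀ h₁ γ₀ γ₁ ρ σ φ hε)]
  simp only [mollifiedKernel, integral_smul_const]

end Reproducing

section Superposition

variable {Ψ : (Rd d × Rd d) × (Rd d × Rd d) → E} {N : ℕ}

theorem norm_smul_le_of_norm_le_pairWeight {k : ℂ} {C : ℝ} {p : (Rd d × Rd d) × (Rd d × Rd d)}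
    (hk : ‖k‖ ≤ C * pairWeight (-N) p) (y : E) : ‖k • y‖ ≤ C * (pairWeight (-N) p * ‖y‖) := by
  rw [norm_smul, ← mul_assoc]
  gcongr

theorem productKernel_add (h₀ h₁ φ ψ : 𝓢(Rd d, ℂ)) (p : (Rd d × Rd d) × (Rd d × Rd d)) :
    productKernel h₀ h₁ (φ + ψ) p = productKernel h₀ h₁ φ p + productKernel h₀ h₁ ψ p := by
  simp [productKernel, tfCoeff, fourierInv_add]

theorem productKernel_smul (h₀ h₁ φ : 𝓢(Rd d, ℂ)) (a : ℂ)
    (p : (Rd d × Rd d) × (Rd d × Rd d)) :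
    productKernel h₀ h₁ (a • φ) p = a * productKernel h₀ h₁ φ p := by
  simp [productKernel, tfCoeff, fourierInv_smul]

theorem integrable_productKernel_smul (h₀ h₁ : 𝓢(Rd d, ℂ)) (hΨ : AEStronglyMeasurable Ψ)
    (hN : Integrable fun p => pairWeight (-N) p * ‖Ψ p‖) (φ : 𝓢(Rd d, ℂ)) :
    Integrable fun p => productKernel h₀ h₁ φ p • Ψ p := by
  obtain ⟨m, C, -, hb⟩ := exists_norm_productKernel_le h₀ h₁ N
  exact (hN.const_mul _).mono'
    ((continuous_productKernel h₀ h₁ φ).aestronglyMeasurable.smul hΨ)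
    (Eventually.of_forall fun p => norm_smul_le_of_norm_le_pairWeight (hb φ p) _)

/-- The tempered distribution `φ ↦ ∫ p, productKernel h₀ h₁ φ p • Ψ p`: the superposition with
amplitude `Ψ` of the products of a time-frequency shift of `h₀` and one of `h₁`. -/
noncomputable def superposition (h₀ h₁ : 𝓢(Rd d, ℂ)) (hΨ : AEStronglyMeasurable Ψ)
    (hN : Integrable fun p => pairWeight (-N) p * ‖Ψ p‖) : 𝓢'(Rd d, E) :=
  ContinuousLinearMap.toPointwiseConvergenceCLM _ _ _ _ <| mkCLMtoNormedSpace
    (fun φ => ∫ p, productKernel h₀ h₁ φ p • Ψ p)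
    (fun φ ψ => by
      simp only [productKernel_add, add_smul]
      exact integral_add (integrable_productKernel_smul h₀ h₁ hΨ hN φ)
        (integrable_productKernel_smul h₀ h₁ hΨ hN ψ))
    (fun a φ => by
      simp only [productKernel_smul, mul_smul]
      exact integral_smul _ _)
    (by
      obtain ⟨m, C, hC, hb⟩ := exists_norm_productKernel_le h₀ h₁ N
      have hD : 0 ≤ ∫ p, pairWeight (-N) p * ‖Ψ p‖ := integral_nonneg fun p =>
        mul_nonneg (pairWeight_nonneg _ p) (norm_nonneg _)
      refine ⟨Finset.Iic (m, m), C * ∫ p, pairWeight (-N) p * ‖Ψ p‖, by positivity, fun φ => ?_⟩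
      refine (norm_integral_le_of_norm_le (hN.const_mul (C * schwartzNorm m φ))
        (Eventually.of_forall fun p => norm_smul_le_of_norm_le_pairWeight (hb φ p) _)).trans_eq ?_
      rw [integral_const_mul, mul_right_comm]
      rfl)

theorem superposition_apply (h₀ h₁ : 𝓢(Rd d, ℂ)) (hΨ : AEStronglyMeasurable Ψ)
    (hN : Integrable fun p => pairWeight (-N) p * ‖Ψ p‖) (φ : 𝓢(Rd d, ℂ)) :
    superposition h₀ h₁ hΨ hN φ = ∫ p, productKernel h₀ h₁ φ p • Ψ p := rfl

theorem tendsto_integral_mollifiedKernel_smul (h₀ h₁ φ : 𝓢(Rd d, ℂ)) {ρ σ : 𝓢(Rd d, ℂ)}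
    (hρ : ∫ x, ρ x = 1) (hσ : ∫ x, σ x = 1) (hΨ : AEStronglyMeasurable Ψ)
    (hN : Integrable fun p => pairWeight (-N) p * ‖Ψ p‖) :
    Tendsto (fun ε => ∫ p, mollifiedKernel h₀ h₁ ρ σ φ ε p • Ψ p) (𝓝[>] 0)
      (𝓝 (∫ p, productKernel h₀ h₁ φ p • Ψ p)) := by
  obtain ⟨C, hC⟩ := exists_norm_mollifiedKernel_le h₀ h₁ ρ σ φ N
  refine tendsto_integral_filter_of_dominated_convergence
    (fun p => C * (pairWeight (-N) p * ‖Ψ p‖)) ?_ ?_ (hN.const_mul _)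
    (Eventually.of_forall fun p => (tendsto_mollifiedKernel h₀ h₁ φ hρ hσ p).smul_const _)
  · filter_upwards [self_mem_nhdsWithin] with ε hε
    exact (stronglyMeasurable_mollifiedKernel h₀ h₁ ρ σ φ
      (ne_of_gt hε)).aestronglyMeasurable.smul hΨ
  · filter_upwards [Ioc_mem_nhdsGT one_pos] with ε hε
    exact Eventually.of_forall fun p => norm_smul_le_of_norm_le_pairWeight (hC ε hε.1 hε.2 p) _

end Superposition

theorem isDistribProduct_superposition [CompleteSpace E₂] (u : 𝓢'(Rd d, E₀)) (v : 𝓢'(Rd d, E₁))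
    (hγ₀ : ∫ y, h₀ y * γ₀ y = 1) (hγ₁ : ∫ y, h₁ y * γ₁ y = 1) {N : ℕ}
    (hN : Integrable fun p => pairWeight (-N) p * ‖pairSTFT B u v γ₀ γ₁ p‖) :
    IsDistribProduct B u v (superposition h₀ h₁
      (continuous_pairSTFT B u v γ₀ γ₁).aestronglyMeasurable hN) := by
  intro ρ σ hρ hσ φ
  refine ⟨?_, (tendsto_integral_mollifiedKernel_smul h₀ h₁ φ hρ hσ
    (continuous_pairSTFT B u v γ₀ γ₁).aestronglyMeasurable hN).congr' ?_⟩
  · filter_upwards [self_mem_nhdsWithin] with ε hε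
    exact integrable_smul_regularized_product B u v hγ₀ hγ₁ ρ σ φ (ne_of_gt hε)
  · filter_upwards [self_mem_nhdsWithin] with ε hε
    exact (integral_smul_regularized_product B u v hγ₀ hγ₁ ρ σ φ (ne_of_gt hε)).symm

end Products

/-! ### Mixed norms -/

section Minkowski

variable {X Q : Type*} [MeasurableSpace X] [MeasurableSpace Q]

theorem rpow_lintegral_le_of_weight {ν : Measure Q} {h n : Q → ℝ≥0∞} (hh : Measurable h)
    (hn : Measurable n) (hn_top : ∀ᵐ a ∂ν, n a ≠ ∞) (hn_zero : ∀ᵐ a ∂ν, n a = 0 → h a = 0)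
    {P : ℝ} (hP : 1 ≤ P) :
    (∫⁻ a, h a ∂ν) ^ P ≤ (∫⁻ a, n a ∂ν) ^ (P - 1) * ∫⁻ a, n a ^ (1 - P) * h a ^ P ∂ν := by
  have hP0 : 0 < P := by linarith
  have hexp : 0 ≤ (P - 1) / P := div_nonneg (by linarith) hP0.le
  have hsplit : ∫⁻ a, h a ∂ν
      = ∫⁻ a, n a ^ ((P - 1) / P) * (n a ^ (1 - P) * h a ^ P) ^ (1 / P) ∂ν := by
    refine lintegral_congr_ae ?_
    filter_upwards [hn_top, hn_zero] with a ha_top ha_zero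
    rw [ENNReal.mul_rpow_of_nonneg _ _ (by positivity), ← ENNReal.rpow_mul, ← ENNReal.rpow_mul,
      mul_one_div_cancel hP0.ne', ENNReal.rpow_one, ← mul_assoc]
    rcases eq_or_ne (n a) 0 with h0 | h0
    · simp [ha_zero h0]
    · rw [← ENNReal.rpow_add _ _ h0 ha_top, show (P - 1) / P + (1 - P) * (1 / P) = 0 by ring,
        ENNReal.rpow_zero, one_mul]
  have hholder := ENNReal.lintegral_mul_norm_pow_le (μ := ν) hn.aemeasurable
    ((hn.pow_const (1 - P)).mul (hh.pow_const P)).aemeasurable hexp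
    (by positivity : 0 ≤ 1 / P) (by field_simp; ring)
  calc (∫⁻ a, h a ∂ν) ^ P
      ≤ ((∫⁻ a, n a ∂ν) ^ ((P - 1) / P) * (∫⁻ a, n a ^ (1 - P) * h a ^ P ∂ν) ^ (1 / P)) ^ P := by
        rw [hsplit]
        exact ENNReal.rpow_le_rpow hholder hP0.le
    _ = _ := by
        rw [ENNReal.mul_rpow_of_nonneg _ _ hP0.le, ← ENNReal.rpow_mul, ← ENNReal.rpow_mul,
          one_div_mul_cancel hP0.ne', div_mul_cancel₀ _ hP0.ne', ENNReal.rpow_one]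

theorem rpow_one_sub_mul_rpow_le (n : ℝ≥0∞) {P : ℝ} (hP : 1 ≤ P) : n ^ (1 - P) * n ^ P ≤ n := by
  rcases eq_or_ne n 0 with rfl | h0
  · simp [ENNReal.zero_rpow_of_pos (zero_lt_one.trans_le hP)]
  rcases eq_or_ne n ∞ with rfl | ht
  · exact le_top
  rw [← ENNReal.rpow_add _ _ h0 ht, sub_add_cancel, ENNReal.rpow_one]

theorem ae_ae_eq_zero_of_lintegral_rpow_eq_zero {μ : Measure X} {ν : Measure Q} [SFinite μ]
    [SFinite ν] {H : X → Q → ℝ≥0∞} (hH : Measurable (Function.uncurry H)) {P : ℝ} (hP : 0 < P) :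
    ∀ᵐ x ∂μ, ∀ᵐ a ∂ν, ∫⁻ x, H x a ^ P ∂μ = 0 → H x a = 0 := by
  have hHP : Measurable fun z : X × Q => H z.1 z.2 ^ P := hH.pow_const P
  have hmass : Measurable fun a => ∫⁻ x, H x a ^ P ∂μ := hHP.lintegral_prod_left'
  rw [Measure.ae_ae_comm]
  · refine Eventually.of_forall fun a => ?_
    by_cases h0 : ∫⁻ x, H x a ^ P ∂μ = 0
    · have hae := (lintegral_eq_zero_iff (hHP.comp measurable_prodMk_right)).1 h0
      filter_upwards [hae] with x hx _
      exact (ENNReal.rpow_eq_zero_iff_of_pos hP).1 hx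
    · exact Eventually.of_forall fun x h => absurd h h0
  · simp only [imp_iff_not_or]
    exact ((measurableSet_eq_fun (hmass.comp measurable_snd) measurable_const).compl).union
      (measurableSet_eq_fun hH measurable_const)

theorem lintegral_rpow_lintegral_le {μ : Measure X} {ν : Measure Q} [SFinite μ] [SFinite ν]
    {H : X → Q → ℝ≥0∞} (hH : Measurable (Function.uncurry H)) {P : ℝ} (hP : 1 ≤ P) :
    (∫⁻ x, (∫⁻ a, H x a ∂ν) ^ P ∂μ) ^ (1 / P)
      ≤ ∫⁻ a, (∫⁻ x, H x a ^ P ∂μ) ^ (1 / P) ∂ν := by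
  have hP0 : 0 < P := by linarith
  let n : Q → ℝ≥0∞ := fun a => (∫⁻ x, H x a ^ P ∂μ) ^ (1 / P)
  have hHP : Measurable fun z : X × Q => H z.1 z.2 ^ P := hH.pow_const P
  have hHPa (a : Q) : Measurable fun x => H x a ^ P := hHP.comp measurable_prodMk_right
  have hn : Measurable n := (hHP.lintegral_prod_left' (μ := μ)).pow_const _
  have hnP (a : Q) : ∫⁻ x, H x a ^ P ∂μ = n a ^ P := by
    rw [← ENNReal.rpow_mul, one_div_mul_cancel hP0.ne', ENNReal.rpow_one]
  change _ ≤ ∫⁻ a, n a ∂ν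
  rcases eq_or_ne (∫⁻ a, n a ∂ν) ∞ with hT | hT
  · exact hT ▸ le_top
  have hweighted : Measurable fun z : X × Q => n z.2 ^ (1 - P) * H z.1 z.2 ^ P :=
    ((hn.comp measurable_snd).pow_const _).mul hHP
  have hpow : ∫⁻ x, (∫⁻ a, H x a ∂ν) ^ P ∂μ ≤ (∫⁻ a, n a ∂ν) ^ P := by
    calc ∫⁻ x, (∫⁻ a, H x a ∂ν) ^ P ∂μ
        ≤ ∫⁻ x, (∫⁻ a, n a ∂ν) ^ (P - 1) * ∫⁻ a, n a ^ (1 - P) * H x a ^ P ∂ν ∂μ := by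
          refine lintegral_mono_ae ?_
          filter_upwards [ae_ae_eq_zero_of_lintegral_rpow_eq_zero (μ := μ) (ν := ν) hH hP0]
            with x hx
          refine rpow_lintegral_le_of_weight (hH.comp measurable_prodMk_left) hn
            ((ae_lt_top hn hT).mono fun a ha => ha.ne) (hx.mono fun a ha hna => ha ?_) hP
          rw [hnP, hna, ENNReal.zero_rpow_of_pos hP0]
      _ = (∫⁻ a, n a ∂ν) ^ (P - 1) * ∫⁻ a, ∫⁻ x, n a ^ (1 - P) * H x a ^ P ∂μ ∂ν := by
          rw [lintegral_const_mul _ hweighted.lintegral_prod_right', lintegral_lintegral_swap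
            (f := fun x a => n a ^ (1 - P) * H x a ^ P) hweighted.aemeasurable]
      _ ≤ (∫⁻ a, n a ∂ν) ^ (P - 1) * ∫⁻ a, n a ∂ν := by
          gcongr with a
          rw [lintegral_const_mul _ (hHPa a), hnP]
          exact rpow_one_sub_mul_rpow_le _ hP
      _ = (∫⁻ a, n a ∂ν) ^ P := by
          nth_rewrite 2 [← ENNReal.rpow_one (∫⁻ a, n a ∂ν)]
          rw [← ENNReal.rpow_add_of_nonneg _ _ (by linarith) zero_le_one, sub_add_cancel]
  calc _ ≤ ((∫⁻ a, n a ∂ν) ^ P) ^ (1 / P) := ENNReal.rpow_le_rpow hpow (by positivity)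
    _ = _ := by rw [← ENNReal.rpow_mul, mul_one_div_cancel hP0.ne', ENNReal.rpow_one]

theorem eLpNorm_top_lintegral_le {μ : Measure X} {ν : Measure Q} [SFinite μ] [SFinite ν]
    {H : X → Q → ℝ≥0∞} (hH : Measurable (Function.uncurry H))
    (hn : Measurable fun a => eLpNorm (fun x => H x a) ∞ μ) :
    eLpNorm (fun x => ∫⁻ a, H x a ∂ν) ∞ μ ≤ ∫⁻ a, eLpNorm (fun x => H x a) ∞ μ ∂ν := by
  have hae : ∀ᵐ x ∂μ, ∀ᵐ a ∂ν, H x a ≤ eLpNorm (fun x => H x a) ∞ μ := by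
    have hmeas : MeasurableSet {z : X × Q | H z.1 z.2 ≤ eLpNorm (fun x => H x z.2) ∞ μ} :=
      measurableSet_le hH (hn.comp measurable_snd)
    rw [Measure.ae_ae_comm hmeas]
    exact Eventually.of_forall fun a => ae_le_eLpNormEssSup (f := fun x => H x a)
  rw [eLpNorm_exponent_top]
  refine essSup_le_of_ae_le _ ?_
  filter_upwards [hae] with x hx
  exact lintegral_mono_ae hx

/-- The inner norms are assumed measurable because for `p = ∞` this does not follow from the
measurability of `H`. -/
theorem eLpNorm_lintegral_le {μ : Measure X} {ν : Measure Q} [SFinite μ] [SFinite ν]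
    {H : X → Q → ℝ≥0∞} (hH : Measurable (Function.uncurry H)) {p : ℝ≥0∞} (hp : 1 ≤ p)
    (hn : Measurable fun a => eLpNorm (fun x => H x a) p μ) :
    eLpNorm (fun x => ∫⁻ a, H x a ∂ν) p μ ≤ ∫⁻ a, eLpNorm (fun x => H x a) p μ ∂ν := by
  rcases eq_or_ne p ∞ with rfl | hp_top
  · exact eLpNorm_top_lintegral_le hH hn
  · simp only [eLpNorm_eq_lintegral_rpow_enorm_toReal (zero_lt_one.trans_le hp).ne' hp_top,
      enorm_eq_self]
    exact lintegral_rpow_lintegral_le hH (by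
      simpa only [ENNReal.toReal_one] using ENNReal.toReal_mono hp_top hp)

end Minkowski

section MixedNorms

variable {X Y : Type*} [MeasureSpace X] [MeasureSpace Y]

/-- The `L^q` norm in the second variable of the `L^p` norm in the first variable. -/
noncomputable def mixedNorm (p q : ℝ≥0∞) (F : X → Y → ℝ≥0∞) : ℝ≥0∞ :=
  eLpNorm (fun y => eLpNorm (fun x => F x y) p volume) q volume

theorem mixedNorm_le_mul {p q c : ℝ≥0∞} (hc : c ≠ ∞) {F G : X → Y → ℝ≥0∞}
    (h : ∀ x y, F x y ≤ c * G x y) : mixedNorm p q F ≤ c * mixedNorm p q G := by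
  lift c to NNReal using hc
  refine eLpNorm_le_mul_eLpNorm_of_ae_le_mul' (Eventually.of_forall fun y => ?_) q
  simp only [enorm_eq_self]
  refine eLpNorm_le_mul_eLpNorm_of_ae_le_mul' (Eventually.of_forall fun x => ?_) p
  simpa only [enorm_eq_self] using h x y

theorem eLpNorm_const_top [NeZero (volume : Measure X)] {p : ℝ≥0∞} (hp : p ≠ 0) :
    eLpNorm (fun _ : X => (∞ : ℝ≥0∞)) p volume = ∞ := by
  rw [eLpNorm_const _ hp (NeZero.ne _), enorm_eq_self]
  refine ENNReal.top_mul ?_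
  have huniv : volume (Set.univ : Set X) ≠ 0 := Measure.measure_univ_ne_zero.2 (NeZero.ne _)
  simp only [ne_eq, ENNReal.rpow_eq_zero_iff, huniv, false_and, false_or, not_and, not_lt]
  exact fun _ => by positivity

theorem exists_ne_top_of_mixedNorm_ne_top [NeZero (volume : Measure X)]
    [NeZero (volume : Measure Y)] {p q : ℝ≥0∞} (hp : p ≠ 0) (hq : q ≠ 0) {F : X → Y → ℝ≥0∞}
    (hF : mixedNorm p q F ≠ ∞) : ∃ x y, F x y ≠ ∞ := by
  by_contra! h
  refine hF ?_
  simp only [mixedNorm, h, eLpNorm_const_top hp, eLpNorm_const_top hq]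

section Continuous

variable [TopologicalSpace X] {μ : Measure X}

theorem le_eLpNorm_top_of_continuous [μ.IsOpenPosMeasure] {f : X → ℝ≥0∞} (hf : Continuous f)
    (x : X) : f x ≤ eLpNorm f ∞ μ := by
  have hdense : Dense {x | f x ≤ eLpNorm f ∞ μ} :=
    Measure.dense_of_ae (ae_le_eLpNormEssSup (f := f))
  exact (isClosed_le hf continuous_const).closure_subset (hdense x)

theorem eLpNorm_top_eq_iSup_of_continuous [μ.IsOpenPosMeasure] {f : X → ℝ≥0∞}
    (hf : Continuous f) : eLpNorm f ∞ μ = ⨆ x, f x := by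
  refine le_antisymm ?_ (iSup_le (le_eLpNorm_top_of_continuous hf))
  rw [eLpNorm_exponent_top]
  exact essSup_le_of_ae_le _ (Eventually.of_forall fun x => le_iSup f x)

variable [TopologicalSpace Y] [OpensMeasurableSpace X] [OpensMeasurableSpace Y]
  [SecondCountableTopologyEither X Y]

theorem measurable_eLpNorm_of_continuous [SFinite μ] [μ.IsOpenPosMeasure] {F : X → Y → ℝ≥0∞}
    (hF : Continuous (Function.uncurry F)) (p : ℝ≥0∞) :
    Measurable fun y => eLpNorm (fun x => F x y) p μ := by
  rcases eq_or_ne p 0 with rfl | hp0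
  · simp
  rcases eq_or_ne p ∞ with rfl | hp_top
  · have hFx (y : Y) : Continuous fun x => F x y := hF.comp (Continuous.prodMk_left y)
    simp only [eLpNorm_top_eq_iSup_of_continuous (hFx _)]
    exact (lowerSemicontinuous_iSup fun x =>
      (hF.comp (Continuous.prodMk_right x)).lowerSemicontinuous).measurable
  · simp only [eLpNorm_eq_lintegral_rpow_enorm_toReal hp0 hp_top, enorm_eq_self]
    exact ((hF.measurable.pow_const p.toReal).lintegral_prod_left' (μ := μ)).pow_const _

end Continuous

theorem eLpNorm_comp_add_right [AddGroup X] [MeasurableAdd X]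
    [(volume : Measure X).IsAddRightInvariant] {f : X → ℝ≥0∞} (hf : Measurable f) (p : ℝ≥0∞)
    (t : X) : eLpNorm (fun x => f (x + t)) p volume = eLpNorm f p volume :=
  eLpNorm_comp_measurePreserving hf.aestronglyMeasurable (measurePreserving_add_right volume t)

section Translates

variable [TopologicalSpace X] [OpensMeasurableSpace X] [AddGroup X] [MeasurableAdd₂ X]
  [SFinite (volume : Measure X)] [(volume : Measure X).IsAddRightInvariant]
  [(volume : Measure X).IsOpenPosMeasure]
  [TopologicalSpace Y] [OpensMeasurableSpace Y] [AddGroup Y] [MeasurableAdd₂ Y]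
  [SFinite (volume : Measure Y)] [(volume : Measure Y).IsAddRightInvariant]
  [SecondCountableTopologyEither X Y]
  {Q : Type*} [MeasurableSpace Q] {ν : Measure Q} [SFinite ν]
  {F : X → Y → ℝ≥0∞} {t : Q → X} {o : Q → Y}

theorem mixedNorm_lintegral_translate_le (hF : Continuous (Function.uncurry F))
    (ht : Measurable t) (ho : Measurable o) {p q : ℝ≥0∞} (hp : 1 ≤ p) (hq : 1 ≤ q) :
    mixedNorm p q (fun x y => ∫⁻ a, F (x + t a) (y + o a) ∂ν)
      ≤ ν Set.univ * mixedNorm p q F := by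
  let n : Y → ℝ≥0∞ := fun y => eLpNorm (fun x => F x y) p volume
  have hn : Measurable n := measurable_eLpNorm_of_continuous hF p
  have htranslate (y : Y) (a : Q) :
      eLpNorm (fun x => F (x + t a) (y + o a)) p volume = n (y + o a) :=
    eLpNorm_comp_add_right (f := fun x => F x (y + o a))
      (hF.comp (Continuous.prodMk_left _)).measurable p (t a)
  have hinner (y : Y) :
      eLpNorm (fun x => ∫⁻ a, F (x + t a) (y + o a) ∂ν) p volume ≤ ∫⁻ a, n (y + o a) ∂ν := by
    simp only [← htranslate]
    refine eLpNorm_lintegral_le ?_ hp ?_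
    · exact hF.measurable.comp ((measurable_fst.add (ht.comp measurable_snd)).prodMk
        (measurable_const.add (ho.comp measurable_snd)))
    · simp only [htranslate]
      exact hn.comp (measurable_const.add ho)
  calc mixedNorm p q (fun x y => ∫⁻ a, F (x + t a) (y + o a) ∂ν)
      ≤ eLpNorm (fun y => ∫⁻ a, n (y + o a) ∂ν) q volume :=
        eLpNorm_mono_enorm fun y => by simpa only [enorm_eq_self] using hinner y
    _ ≤ ∫⁻ a, eLpNorm (fun y => n (y + o a)) q volume ∂ν := by
        refine eLpNorm_lintegral_le ?_ hq ?_
        · exact hn.comp (measurable_fst.add (ho.comp measurable_snd))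
        · simp only [eLpNorm_comp_add_right hn]
          exact measurable_const
    _ = ν Set.univ * mixedNorm p q F := by
        simp only [eLpNorm_comp_add_right hn, lintegral_const]
        exact mul_comm _ _

theorem mixedNorm_lintegral_mul_translate_le {θ : Q → ℝ≥0∞} (hθ : Measurable θ)
    (hF : Continuous (Function.uncurry F)) (ht : Measurable t) (ho : Measurable o)
    {p q : ℝ≥0∞} (hp : 1 ≤ p) (hq : 1 ≤ q) :
    mixedNorm p q (fun x y => ∫⁻ a, θ a * F (x + t a) (y + o a) ∂ν)
      ≤ (∫⁻ a, θ a ∂ν) * mixedNorm p q F := by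
  have hFa (x : X) (y : Y) : Measurable fun a => F (x + t a) (y + o a) :=
    hF.measurable.comp ((measurable_const.add ht).prodMk (measurable_const.add ho))
  have hdensity (x : X) (y : Y) : ∫⁻ a, θ a * F (x + t a) (y + o a) ∂ν
      = ∫⁻ a, F (x + t a) (y + o a) ∂ν.withDensity θ :=
    (lintegral_withDensity_eq_lintegral_mul ν hθ (hFa x y)).symm
  simp only [hdensity]
  refine (mixedNorm_lintegral_translate_le hF ht ho hp hq).trans_eq ?_
  rw [withDensity_apply _ MeasurableSet.univ, Measure.restrict_univ]

end Translates

end MixedNorms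

section WeightedSTFT

variable {d : ℕ} {E : Type*} [NormedAddCommGroup E] [NormedSpace ℂ E]

instance isAddLeftInvariant_volume_prod {X Y : Type*} [MeasureSpace X] [Add X]
    [MeasurableAdd X] [SFinite (volume : Measure X)] [(volume : Measure X).IsAddLeftInvariant]
    [MeasureSpace Y] [Add Y] [MeasurableAdd Y] [SFinite (volume : Measure Y)]
    [(volume : Measure Y).IsAddLeftInvariant] :
    (volume : Measure (X × Y)).IsAddLeftInvariant :=
  Measure.prod.instIsAddLeftInvariant

theorem bracketPow_mul_bracketPow_neg_le {t k n : ℝ} (h : |t| + k ≤ n) (x y : Rd d) :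
    bracketPow t x * bracketPow (-n) y
      ≤ 2 ^ (|t| / 2) * (bracketPow t (x + y) * bracketPow (-k) y) := by
  have hpeetre := bracketPow_add_le t (x + y) (-y)
  rw [add_neg_cancel_right, bracketPow_neg_arg] at hpeetre
  have hxy := bracketPow_nonneg t (x + y)
  have hn := bracketPow_nonneg (-n) y
  calc bracketPow t x * bracketPow (-n) y
      ≤ 2 ^ (|t| / 2) * bracketPow t (x + y) * bracketPow |t| y * bracketPow (-n) y := by gcongr
    _ = 2 ^ (|t| / 2) * (bracketPow t (x + y) * bracketPow (|t| + -n) y) := by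
        rw [bracketPow_add]
        ring
    _ ≤ _ := by
        gcongr
        exact bracketPow_mono (by linarith) y

/-- The norm of the short-time Fourier transform of `v` with window `γ`, with the weight
`⟨x⟩ ^ r * ⟨ξ⟩ ^ s`. -/
noncomputable def weightedSTFT (r s : ℝ) (γ : 𝓢(Rd d, ℂ)) (v : 𝓢(Rd d, ℂ) →L[ℂ] E)
    (x ξ : Rd d) : ℝ≥0∞ :=
  ENNReal.ofReal (bracketPow r x * bracketPow s ξ) * ‖clmSTFT γ v (x, ξ)‖ₑ

theorem continuous_weightedSTFT (r s : ℝ) (γ : 𝓢(Rd d, ℂ)) (v : 𝓢(Rd d, ℂ) →L[ℂ] E) :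
    Continuous (Function.uncurry (weightedSTFT r s γ v)) := by
  have hr : Continuous fun z : Rd d × Rd d => bracketPow r z.1 * bracketPow s z.2 := by fun_prop
  refine (show Continuous fun z : Rd d × Rd d => ENNReal.ofReal
    (bracketPow r z.1 * bracketPow s z.2 * ‖clmSTFT γ v z‖) by
      exact ENNReal.continuous_ofReal.comp (hr.mul (continuous_clmSTFT γ v).norm)).congr
    fun z => ?_
  rw [ENNReal.ofReal_mul (mul_nonneg (bracketPow_nonneg _ _) (bracketPow_nonneg _ _)),
    ofReal_norm]
  rfl

theorem enorm_clm_apply_le_lintegral {h γ : 𝓢(Rd d, ℂ)} (hγ : ∫ y, h y * γ y = 1)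
    (v : 𝓢(Rd d, ℂ) →L[ℂ] E) (φ : 𝓢(Rd d, ℂ)) :
    ‖v φ‖ₑ ≤ ∫⁻ z : Rd d × Rd d, ‖tfCoeff h φ z.1 z.2‖ₑ * ‖clmSTFT γ v z‖ₑ := by
  obtain ⟨l, hl, hlv⟩ := exists_dual_vector'' ℂ (v φ)
  have hreproduce := clm_apply_eq_integral_tfCoeff_smul (l.comp v) hγ φ
  calc ‖v φ‖ₑ = ‖(l.comp v) φ‖ₑ := by
        rw [ContinuousLinearMap.comp_apply, hlv, ← ofReal_norm, ← ofReal_norm]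
        simp
    _ ≤ ∫⁻ z : Rd d × Rd d, ‖tfCoeff h φ z.1 z.2 • l.comp v (tfShift γ z.1 z.2)‖ₑ := by
        rw [hreproduce]
        exact enorm_integral_le_lintegral_enorm _
    _ ≤ _ := by
        gcongr with z
        rw [enorm_smul, ContinuousLinearMap.comp_apply]
        gcongr
        exact enorm_le_iff_norm_le.2 ((l.le_of_opNorm_le hl _).trans_eq (one_mul _))

theorem enorm_clmSTFT_le_lintegral {h γ : 𝓢(Rd d, ℂ)} (hγ : ∫ y, h y * γ y = 1)
    (γ' : 𝓢(Rd d, ℂ)) (v : 𝓢(Rd d, ℂ) →L[ℂ] E) (x ξ : Rd d) :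
    ‖clmSTFT γ' v (x, ξ)‖ₑ
      ≤ ∫⁻ a : Rd d × Rd d, ‖tfCoeff h γ' a.1 a.2‖ₑ * ‖clmSTFT γ v (x + a.1, ξ + a.2)‖ₑ := by
  refine (enorm_clm_apply_le_lintegral hγ v (tfShift γ' x ξ)).trans_eq ?_
  rw [← lintegral_add_left_eq_self _ (x, ξ)]
  refine lintegral_congr fun a => ?_
  rw [← ofReal_norm (tfCoeff h _ _ _), norm_tfCoeff_tfShift, ofReal_norm]
  simp only [Prod.fst_add, Prod.snd_add, add_sub_cancel_left]
  rfl

theorem exists_bracketPow_mul_norm_tfCoeff_le (h φ : 𝓢(Rd d, ℂ)) (r s k : ℝ) :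
    ∃ C : ℝ, 0 ≤ C ∧ ∀ x ξ y η, bracketPow r x * bracketPow s ξ * ‖tfCoeff h φ y η‖
      ≤ C * (bracketPow (-k) y * bracketPow (-k) η
        * (bracketPow r (x + y) * bracketPow s (ξ + η))) := by
  obtain ⟨N, hN⟩ := exists_nat_ge (|r| + |s| + k)
  obtain ⟨m, C, hC, hdecay⟩ := exists_norm_tfCoeff_le_bracketPow h N
  let D : ℝ := C * schwartzNorm m φ
  refine ⟨D * (2 ^ (|r| / 2) * 2 ^ (|s| / 2)), by positivity, fun x ξ y η => ?_⟩
  have hx := bracketPow_mul_bracketPow_neg_le (by linarith [abs_nonneg s] : |r| + k ≤ N) x y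
  have hξ := bracketPow_mul_bracketPow_neg_le (by linarith [abs_nonneg r] : |s| + k ≤ N) ξ η
  have hw := mul_nonneg (bracketPow_nonneg r x) (bracketPow_nonneg s ξ)
  have hwξ := mul_nonneg (bracketPow_nonneg s ξ) (bracketPow_nonneg (-N) η)
  calc _ ≤ bracketPow r x * bracketPow s ξ
          * (D * (bracketPow (-N) y * bracketPow (-N) η)) := by
        gcongr
        exact hdecay φ y η
    _ = D * ((bracketPow r x * bracketPow (-N) y)
          * (bracketPow s ξ * bracketPow (-N) η)) := by ring
    _ ≤ D * ((2 ^ (|r| / 2) * (bracketPow r (x + y) * bracketPow (-k) y))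
          * (2 ^ (|s| / 2) * (bracketPow s (ξ + η) * bracketPow (-k) η))) := by
        gcongr
        exact (mul_nonneg (bracketPow_nonneg _ _) (bracketPow_nonneg _ _)).trans hx
    _ = _ := by ring

theorem exists_weightedSTFT_le_lintegral {γ : 𝓢(Rd d, ℂ)} (hγ : γ ≠ 0) (γ' : 𝓢(Rd d, ℂ))
    (r s k : ℝ) : ∃ C : ℝ, ∀ (v : 𝓢(Rd d, ℂ) →L[ℂ] E) (x ξ : Rd d),
      weightedSTFT r s γ' v x ξ ≤ ENNReal.ofReal C * ∫⁻ a : Rd d × Rd d,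
        ENNReal.ofReal (bracketPow (-k) a.1 * bracketPow (-k) a.2)
          * weightedSTFT r s γ v (x + a.1) (ξ + a.2) := by
  obtain ⟨h, hh⟩ := exists_dual_window hγ
  obtain ⟨C, hC, hweight⟩ := exists_bracketPow_mul_norm_tfCoeff_le h γ' r s k
  refine ⟨C, fun v x ξ => ?_⟩
  rw [← lintegral_const_mul' _ _ ENNReal.ofReal_ne_top]
  calc weightedSTFT r s γ' v x ξ
      ≤ ENNReal.ofReal (bracketPow r x * bracketPow s ξ) * ∫⁻ a : Rd d × Rd d,
          ‖tfCoeff h γ' a.1 a.2‖ₑ * ‖clmSTFT γ v (x + a.1, ξ + a.2)‖ₑ := by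
        unfold weightedSTFT
        gcongr
        exact enorm_clmSTFT_le_lintegral hh γ' v x ξ
    _ ≤ _ := by
        rw [← lintegral_const_mul' _ _ ENNReal.ofReal_ne_top]
        refine lintegral_mono fun a => ?_
        have ha := ENNReal.ofReal_le_ofReal (hweight x ξ a.1 a.2)
        rw [ENNReal.ofReal_mul (mul_nonneg (bracketPow_nonneg _ _) (bracketPow_nonneg _ _)),
          ENNReal.ofReal_mul hC, ofReal_norm,
          ENNReal.ofReal_mul (mul_nonneg (bracketPow_nonneg _ _) (bracketPow_nonneg _ _))] at ha
        simp only [weightedSTFT, ← mul_assoc] at ha ⊢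
        gcongr

theorem exists_mixedNorm_weightedSTFT_le {γ : 𝓢(Rd d, ℂ)} (hγ : γ ≠ 0) (γ' : 𝓢(Rd d, ℂ))
    {p q : ℝ≥0∞} (hp : 1 ≤ p) (hq : 1 ≤ q) (r s : ℝ) :
    ∃ C ≠ ∞, ∀ v : 𝓢(Rd d, ℂ) →L[ℂ] E,
      mixedNorm p q (weightedSTFT r s γ' v) ≤ C * mixedNorm p q (weightedSTFT r s γ v) := by
  obtain ⟨C, hC⟩ := exists_weightedSTFT_le_lintegral (E := E) hγ γ' r s (d + 1)
  have hθ : Integrable fun a : Rd d × Rd d =>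
      bracketPow (-(d + 1)) a.1 * bracketPow (-(d + 1)) a.2 :=
    integrable_bracketPow_prod (by linarith)
  refine ⟨ENNReal.ofReal C * _,
    ENNReal.mul_ne_top ENNReal.ofReal_ne_top hθ.lintegral_lt_top.ne, fun v => ?_⟩
  refine (mixedNorm_le_mul ENNReal.ofReal_ne_top (hC v)).trans ?_
  rw [mul_assoc]
  gcongr
  exact mixedNorm_lintegral_mul_translate_le (by fun_prop) (continuous_weightedSTFT r s γ v)
    measurable_fst measurable_snd hp hq

end WeightedSTFT

/-! ### The product estimate -/

section ProductEstimate

variable {d : ℕ} {E₀ E₁ E₂ : Type*}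
  [NormedAddCommGroup E₀] [NormedSpace ℂ E₀] [NormedAddCommGroup E₁] [NormedSpace ℂ E₁]
  [NormedAddCommGroup E₂] [NormedSpace ℂ E₂]

@[fun_prop]
theorem continuous_pairWeight (r : ℝ) : Continuous (pairWeight (d := d) r) := by
  unfold pairWeight
  fun_prop

theorem bracketPow_mul_pairWeight_le {r s δ k n : ℝ} (h : |r| + |s| + |δ| + k ≤ n) (x ξ : Rd d)
    (a : (Rd d × Rd d) × (Rd d × Rd d)) :
    bracketPow (r + δ) x * bracketPow s ξ * pairWeight (-n) a
      ≤ 2 ^ (|δ| / 2) * 2 ^ (|r| / 2) * (2 ^ (|s| / 2) * 2 ^ (|s| / 2)) * (pairWeight (-k) a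
        * (bracketPow δ (x + a.1.1) * bracketPow |s| a.1.2)
        * (bracketPow r (x + a.2.1) * bracketPow s (ξ + a.2.2))) := by
  obtain ⟨⟨y, η⟩, ⟨y', η'⟩⟩ := a
  have hr := abs_nonneg r
  have hs := abs_nonneg s
  have hδ := abs_nonneg δ
  have hy := bracketPow_mul_bracketPow_neg_le (by linarith : |δ| + k ≤ n) x y
  have hy' := bracketPow_mul_bracketPow_neg_le (by linarith : |r| + k ≤ n) x y'
  have hη : bracketPow |s| η' * bracketPow (-n) (η + η')
      ≤ 2 ^ (|s| / 2) * (bracketPow |s| η * bracketPow (-k) (η + η')) := by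
    have h := bracketPow_mul_bracketPow_neg_le (by rw [abs_abs]; linarith : |(|s|)| + k ≤ n)
      (-η') (η + η')
    rwa [abs_abs, bracketPow_neg_arg, neg_add_eq_sub, add_sub_cancel_right] at h
  have hb (t : ℝ) (z : Rd d) := bracketPow_nonneg t z
  have hξ : bracketPow s ξ * bracketPow (-n) (η + η') ≤ 2 ^ (|s| / 2) * bracketPow s (ξ + η')
      * (2 ^ (|s| / 2) * (bracketPow |s| η * bracketPow (-k) (η + η'))) := by
    have h := bracketPow_add_le s (ξ + η') (-η')
    rw [add_neg_cancel_right, bracketPow_neg_arg] at h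
    refine (mul_le_mul_of_nonneg_right h (hb _ _)).trans ?_
    rw [mul_assoc]
    exact mul_le_mul_of_nonneg_left hη (mul_nonneg (by positivity) (hb _ _))
  calc bracketPow (r + δ) x * bracketPow s ξ * pairWeight (-n) ((y, η), (y', η'))
      = bracketPow δ x * bracketPow (-n) y * (bracketPow r x * bracketPow (-n) y')
          * (bracketPow s ξ * bracketPow (-n) (η + η')) := by
        rw [pairWeight, bracketPow_add]
        ring
    _ ≤ 2 ^ (|δ| / 2) * (bracketPow δ (x + y) * bracketPow (-k) y)
          * (2 ^ (|r| / 2) * (bracketPow r (x + y') * bracketPow (-k) y'))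
          * (2 ^ (|s| / 2) * bracketPow s (ξ + η')
            * (2 ^ (|s| / 2) * (bracketPow |s| η * bracketPow (-k) (η + η')))) := by
        have hbb (t t' : ℝ) (z z' : Rd d) := mul_nonneg (hb t z) (hb t' z')
        exact mul_le_mul (mul_le_mul hy hy' (hbb _ _ _ _) ((hbb _ _ _ _).trans hy)) hξ
          (hbb _ _ _ _) (mul_nonneg ((hbb _ _ _ _).trans hy) ((hbb _ _ _ _).trans hy'))
    _ = _ := by
        rw [pairWeight]
        ring

theorem lintegral_pairWeight_mul (r : ℝ) {A : Rd d → ℝ≥0∞} (hA : Measurable A) :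
    ∫⁻ a : (Rd d × Rd d) × (Rd d × Rd d), ENNReal.ofReal (pairWeight r a) * A a.1.2
      = (∫⁻ x : Rd d, ENNReal.ofReal (bracketPow r x)) ^ 3 * ∫⁻ ξ, A ξ := by
  let b : Rd d → ℝ≥0∞ := fun x => ENNReal.ofReal (bracketPow r x)
  have hb : Measurable b := by fun_prop
  have hsplit (a : (Rd d × Rd d) × (Rd d × Rd d)) : ENNReal.ofReal (pairWeight r a) * A a.1.2
      = b a.1.1 * A a.1.2 * (b a.2.1 * b (a.1.2 + a.2.2)) := by
    rw [pairWeight, ENNReal.ofReal_mul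
      (mul_nonneg (bracketPow_nonneg _ _) (bracketPow_nonneg _ _)),
      ENNReal.ofReal_mul (bracketPow_nonneg _ _)]
    ring
  have hinner (η : Rd d) :
      ∫⁻ z' : Rd d × Rd d, b z'.1 * b (η + z'.2) = (∫⁻ x, b x) * ∫⁻ x, b x := by
    rw [Measure.volume_eq_prod, lintegral_prod_mul (g := fun y => b (η + y)) hb.aemeasurable
      (hb.comp (measurable_const_add η)).aemeasurable, lintegral_add_left_eq_self b η]
  calc _ = ∫⁻ z : Rd d × Rd d, ∫⁻ z' : Rd d × Rd d,
          b z.1 * A z.2 * (b z'.1 * b (z.2 + z'.2)) := by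
        simp only [hsplit]
        rw [Measure.volume_eq_prod, lintegral_prod _ (Measurable.aemeasurable (by fun_prop))]
    _ = ∫⁻ z : Rd d × Rd d, b z.1 * A z.2 * ((∫⁻ x, b x) * ∫⁻ x, b x) := by
        refine lintegral_congr fun z => ?_
        rw [lintegral_const_mul _ (by fun_prop), hinner]
    _ = (∫⁻ x, b x) * (∫⁻ ξ, A ξ) * ((∫⁻ x, b x) * ∫⁻ x, b x) := by
        rw [lintegral_mul_const _ (by fun_prop), Measure.volume_eq_prod,
          lintegral_prod_mul hb.aemeasurable hA.aemeasurable]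
    _ = _ := by ring

/-- The pairing of the moduli of the short-time Fourier transforms of `u` and `v`, localized to
pairs of phase space points whose positions are near `x` and whose frequencies add up to nearly
`ξ`. -/
noncomputable def localPairing (n : ℝ) (γ₀ γ₁ : 𝓢(Rd d, ℂ)) (u : 𝓢(Rd d, ℂ) →L[ℂ] E₀)
    (v : 𝓢(Rd d, ℂ) →L[ℂ] E₁) (x ξ : Rd d) : ℝ≥0∞ :=
  ∫⁻ a : (Rd d × Rd d) × (Rd d × Rd d), ENNReal.ofReal (pairWeight (-n) a)
    * (‖clmSTFT γ₀ u (x + a.1.1, a.1.2)‖ₑ * ‖clmSTFT γ₁ v (x + a.2.1, ξ + a.2.2)‖ₑ)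

theorem ofReal_mul_localPairing_le {r s δ k n : ℝ} (h : |r| + |s| + |δ| + k ≤ n)
    (γ₀ γ₁ : 𝓢(Rd d, ℂ)) (u : 𝓢(Rd d, ℂ) →L[ℂ] E₀) (v : 𝓢(Rd d, ℂ) →L[ℂ] E₁) (x ξ : Rd d) :
    ENNReal.ofReal (bracketPow (r + δ) x * bracketPow s ξ) * localPairing n γ₀ γ₁ u v x ξ
      ≤ ENNReal.ofReal (2 ^ (|δ| / 2) * 2 ^ (|r| / 2) * (2 ^ (|s| / 2) * 2 ^ (|s| / 2)))
        * ∫⁻ a : (Rd d × Rd d) × (Rd d × Rd d), ENNReal.ofReal (pairWeight (-k) a)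
          * eLpNorm (fun y => weightedSTFT δ |s| γ₀ u y a.1.2) ∞ volume
          * weightedSTFT r s γ₁ v (x + a.2.1) (ξ + a.2.2) := by
  rw [localPairing, ← lintegral_const_mul' _ _ ENNReal.ofReal_ne_top,
    ← lintegral_const_mul' _ _ ENNReal.ofReal_ne_top]
  refine lintegral_mono fun a => ?_
  have hu : weightedSTFT δ |s| γ₀ u (x + a.1.1) a.1.2
      ≤ eLpNorm (fun y => weightedSTFT δ |s| γ₀ u y a.1.2) ∞ volume :=
    le_eLpNorm_top_of_continuous
      ((continuous_weightedSTFT δ |s| γ₀ u).comp (Continuous.prodMk_left a.1.2)) _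
  have hbb (t t' : ℝ) (z z' : Rd d) : 0 ≤ bracketPow t z * bracketPow t' z' :=
    mul_nonneg (bracketPow_nonneg _ _) (bracketPow_nonneg _ _)
  have hc : (0 : ℝ) ≤ 2 ^ (|δ| / 2) * 2 ^ (|r| / 2) * (2 ^ (|s| / 2) * 2 ^ (|s| / 2)) := by
    positivity
  have hweight := ENNReal.ofReal_le_ofReal (bracketPow_mul_pairWeight_le h x ξ a)
  rw [ENNReal.ofReal_mul (hbb _ _ _ _), ENNReal.ofReal_mul hc,
    ENNReal.ofReal_mul (mul_nonneg (pairWeight_nonneg _ _) (hbb _ _ _ _)),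
    ENNReal.ofReal_mul (pairWeight_nonneg _ _)] at hweight
  refine le_trans ?_ (mul_le_mul_right (mul_le_mul_left (mul_le_mul_right hu _) _) _)
  rw [weightedSTFT, weightedSTFT, ← mul_assoc]
  refine (mul_le_mul_left hweight _).trans_eq ?_
  ring

theorem mixedNorm_top_one_weightedSTFT (r s : ℝ) (γ : 𝓢(Rd d, ℂ)) (u : 𝓢(Rd d, ℂ) →L[ℂ] E₀) :
    mixedNorm ∞ 1 (weightedSTFT r s γ u)
      = ∫⁻ ξ, eLpNorm (fun x => weightedSTFT r s γ u x ξ) ∞ volume := by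
  rw [mixedNorm, eLpNorm_one_eq_lintegral_enorm]
  simp only [enorm_eq_self]

theorem exists_mixedNorm_localPairing_le {p q : ℝ≥0∞} (hp : 1 ≤ p) (hq : 1 ≤ q) {r s δ n : ℝ}
    (h : |r| + |s| + |δ| + (d + 1) ≤ n) (γ₀ γ₁ : 𝓢(Rd d, ℂ)) :
    ∃ C ≠ ∞, ∀ (u : 𝓢(Rd d, ℂ) →L[ℂ] E₀) (v : 𝓢(Rd d, ℂ) →L[ℂ] E₁),
      mixedNorm p q (fun x ξ => ENNReal.ofReal (bracketPow (r + δ) x * bracketPow s ξ)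
          * localPairing n γ₀ γ₁ u v x ξ)
        ≤ C * mixedNorm ∞ 1 (weightedSTFT δ |s| γ₀ u) * mixedNorm p q (weightedSTFT r s γ₁ v) := by
  have hb : ∫⁻ x : Rd d, ENNReal.ofReal (bracketPow (-(d + 1)) x) ≠ ∞ :=
    (integrable_bracketPow (by linarith)).lintegral_lt_top.ne
  refine ⟨ENNReal.ofReal (2 ^ (|δ| / 2) * 2 ^ (|r| / 2) * (2 ^ (|s| / 2) * 2 ^ (|s| / 2))) * _,
    ENNReal.mul_ne_top ENNReal.ofReal_ne_top (ENNReal.pow_ne_top (n := 3) hb), fun u v => ?_⟩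
  let A : Rd d → ℝ≥0∞ := fun ξ => eLpNorm (fun x => weightedSTFT δ |s| γ₀ u x ξ) ∞ volume
  have hA : Measurable A :=
    measurable_eLpNorm_of_continuous (continuous_weightedSTFT δ |s| γ₀ u) ∞
  have hyoung := mixedNorm_lintegral_mul_translate_le (ν := volume)
    (θ := fun a => ENNReal.ofReal (pairWeight (-(d + 1)) a) * A a.1.2) (t := fun a => a.2.1)
    (o := fun a => a.2.2) (by fun_prop) (continuous_weightedSTFT r s γ₁ v) (by fun_prop)
    (by fun_prop) hp hq
  rw [lintegral_pairWeight_mul _ hA, ← mixedNorm_top_one_weightedSTFT] at hyoung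
  refine (mixedNorm_le_mul ENNReal.ofReal_ne_top
    (ofReal_mul_localPairing_le h γ₀ γ₁ u v)).trans ((mul_le_mul_right hyoung _).trans_eq ?_)
  ring

theorem pairWeight_add_le (r : ℝ) (a c : (Rd d × Rd d) × (Rd d × Rd d)) :
    pairWeight r (a + c) ≤ (2 ^ (|r| / 2)) ^ 3 * (pairWeight r a * pairWeight |r| c) := by
  have hb (t : ℝ) (z : Rd d) := bracketPow_nonneg t z
  have hpeetre (y z : Rd d) := bracketPow_add_le r y z
  have hK (y z : Rd d) : 0 ≤ 2 ^ (|r| / 2) * bracketPow r y * bracketPow |r| z :=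
    (hb _ _).trans (hpeetre y z)
  have hfreq : (a + c).1.2 + (a + c).2.2 = (a.1.2 + a.2.2) + (c.1.2 + c.2.2) :=
    add_add_add_comm _ _ _ _
  rw [pairWeight, hfreq]
  calc _ ≤ _ := mul_le_mul (mul_le_mul (hpeetre a.1.1 c.1.1) (hpeetre a.2.1 c.2.1) (hb _ _)
        (hK _ _)) (hpeetre _ _) (hb _ _) (mul_nonneg (hK _ _) (hK _ _))
    _ = _ := by
      rw [pairWeight, pairWeight]
      ring

theorem lintegral_le_localPairing (B : E₀ →L[ℂ] E₁ →L[ℂ] E₂) (u : 𝓢(Rd d, ℂ) →L[ℂ] E₀)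
    (v : 𝓢(Rd d, ℂ) →L[ℂ] E₁) (γ₀ γ₁ : 𝓢(Rd d, ℂ)) {n C : ℝ} (hC : 0 ≤ C) (x ξ : Rd d)
    {k : (Rd d × Rd d) × (Rd d × Rd d) → ℝ}
    (hk : ∀ a, k (((x, 0), (x, ξ)) + a) ≤ C * pairWeight (-n) a) :
    ∫⁻ p, ENNReal.ofReal (k p) * ‖pairSTFT B u v γ₀ γ₁ p‖ₑ
      ≤ ENNReal.ofReal C * ‖B‖ₑ * localPairing n γ₀ γ₁ u v x ξ := by
  have : (volume : Measure ((Rd d × Rd d) × (Rd d × Rd d))).IsAddLeftInvariant :=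
    isAddLeftInvariant_volume_prod
  rw [← lintegral_add_left_eq_self _ (((x, 0), (x, ξ)) :
    (Rd d × Rd d) × (Rd d × Rd d)), localPairing,
    ← lintegral_const_mul' _ _ (ENNReal.mul_ne_top ENNReal.ofReal_ne_top enorm_ne_top)]
  refine lintegral_mono fun a => ?_
  have ha := ENNReal.ofReal_le_ofReal (hk a)
  have hpair : ‖pairSTFT B u v γ₀ γ₁ (((x, 0), (x, ξ)) + a)‖ₑ ≤ ‖B‖ₑ
      * ‖clmSTFT γ₀ u (x + a.1.1, a.1.2)‖ₑ * ‖clmSTFT γ₁ v (x + a.2.1, ξ + a.2.2)‖ₑ := by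
    have hfreq : (((x, 0), (x, ξ)) + a).1 = (x + a.1.1, a.1.2) :=
      Prod.ext rfl (zero_add a.1.2)
    rw [pairSTFT, hfreq]
    exact B.le_opENorm₂ _ _
  rw [ENNReal.ofReal_mul hC] at ha
  refine (mul_le_mul' ha hpair).trans_eq ?_
  ring

theorem integrable_pairWeight_mul_pairSTFT (B : E₀ →L[ℂ] E₁ →L[ℂ] E₂)
    (u : 𝓢(Rd d, ℂ) →L[ℂ] E₀) (v : 𝓢(Rd d, ℂ) →L[ℂ] E₁) (γ₀ γ₁ : 𝓢(Rd d, ℂ)) {n : ℝ}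
    {x ξ : Rd d} (h : localPairing n γ₀ γ₁ u v x ξ ≠ ∞) :
    Integrable fun p => pairWeight (-n) p * ‖pairSTFT B u v γ₀ γ₁ p‖ := by
  have hcont := (continuous_pairWeight (-n)).mul (continuous_pairSTFT B u v γ₀ γ₁).norm
  refine ⟨hcont.aestronglyMeasurable, ?_⟩
  let c : (Rd d × Rd d) × (Rd d × Rd d) := ((x, 0), (x, ξ))
  have hC : 0 ≤ (2 ^ (|-n| / 2)) ^ 3 * pairWeight |-n| c :=
    mul_nonneg (by positivity) (pairWeight_nonneg _ _)
  have hbound := lintegral_le_localPairing B u v γ₀ γ₁ hC x ξ fun a => by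
    rw [add_comm]
    refine (pairWeight_add_le (-n) a c).trans_eq ?_
    ring
  rw [hasFiniteIntegral_iff_enorm]
  simp only [enorm_mul, enorm_norm, Real.enorm_of_nonneg (pairWeight_nonneg _ _)]
  exact hbound.trans_lt (ENNReal.mul_lt_top (ENNReal.mul_lt_top ENNReal.ofReal_lt_top
    enorm_lt_top) h.lt_top)

theorem exists_enorm_superposition_tfShift_le (h₀ h₁ γ₂ : 𝓢(Rd d, ℂ)) (N : ℕ) :
    ∃ C : ℝ, ∀ (B : E₀ →L[ℂ] E₁ →L[ℂ] E₂) (u : 𝓢(Rd d, ℂ) →L[ℂ] E₀)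
      (v : 𝓢(Rd d, ℂ) →L[ℂ] E₁) (γ₀ γ₁ : 𝓢(Rd d, ℂ))
      (hN : Integrable (fun p => pairWeight (-N) p * ‖pairSTFT B u v γ₀ γ₁ p‖) volume)
      (x ξ : Rd d),
      ‖superposition h₀ h₁ (continuous_pairSTFT B u v γ₀ γ₁).aestronglyMeasurable hN
          (tfShift γ₂ x ξ)‖ₑ
        ≤ ENNReal.ofReal C * ‖B‖ₑ * localPairing N γ₀ γ₁ u v x ξ := by
  obtain ⟨m, C, hC, hdecay⟩ := exists_norm_productKernel_le h₀ h₁ N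
  refine ⟨C * schwartzNorm m γ₂, fun B u v γ₀ γ₁ hN x ξ => ?_⟩
  rw [superposition_apply]
  calc _ ≤ ∫⁻ p, ENNReal.ofReal ‖productKernel h₀ h₁ (tfShift γ₂ x ξ) p‖
          * ‖pairSTFT B u v γ₀ γ₁ p‖ₑ := by
        refine (enorm_integral_le_lintegral_enorm _).trans_eq ?_
        simp only [enorm_smul, ofReal_norm]
    _ ≤ _ := by
        refine lintegral_le_localPairing B u v γ₀ γ₁ (mul_nonneg hC (apply_nonneg _ _)) x ξ
          fun a => ?_
        rw [norm_productKernel_tfShift]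
        exact hdecay γ₂ a

theorem exists_isDistribProduct_mixedNorm_le [CompleteSpace E₂] {p q : ℝ≥0∞} (hp : 1 ≤ p)
    (hq : 1 ≤ q) (r s δ : ℝ) {γ₀ γ₁ : 𝓢(Rd d, ℂ)} (hγ₀ : γ₀ ≠ 0) (hγ₁ : γ₁ ≠ 0)
    (γ₂ : 𝓢(Rd d, ℂ)) :
    ∃ C ≠ ∞, ∀ (B : E₀ →L[ℂ] E₁ →L[ℂ] E₂) (u : 𝓢'(Rd d, E₀)) (v : 𝓢'(Rd d, E₁)),
      mixedNorm ∞ 1 (weightedSTFT δ |s| γ₀ u) ≠ ∞ → mixedNorm p q (weightedSTFT r s γ₁ v) ≠ ∞ →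
      ∃ w, IsDistribProduct B u v w ∧ mixedNorm p q (weightedSTFT (r + δ) s γ₂ w)
        ≤ C * ‖B‖ₑ * mixedNorm ∞ 1 (weightedSTFT δ |s| γ₀ u)
          * mixedNorm p q (weightedSTFT r s γ₁ v) := by
  obtain ⟨N, hN⟩ := exists_nat_ge (|r| + |s| + |δ| + (d + 1))
  obtain ⟨h₀, hh₀⟩ := exists_dual_window hγ₀
  obtain ⟨h₁, hh₁⟩ := exists_dual_window hγ₁
  obtain ⟨C, hC_top, hC⟩ :=
    exists_mixedNorm_localPairing_le (E₀ := E₀) (E₁ := E₁) hp hq hN γ₀ γ₁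
  obtain ⟨K, hK⟩ :=
    exists_enorm_superposition_tfShift_le (E₀ := E₀) (E₁ := E₁) (E₂ := E₂) h₀ h₁ γ₂ N
  refine ⟨ENNReal.ofReal K * C, ENNReal.mul_ne_top ENNReal.ofReal_ne_top hC_top,
    fun B u v hu hv => ?_⟩
  obtain ⟨x, ξ, hxξ⟩ := exists_ne_top_of_mixedNorm_ne_top (zero_lt_one.trans_le hp).ne'
    (zero_lt_one.trans_le hq).ne'
    (ne_top_of_le_ne_top (ENNReal.mul_ne_top (ENNReal.mul_ne_top hC_top hu) hv) (hC u v))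
  have hfinite : localPairing N γ₀ γ₁ u v x ξ ≠ ∞ := fun htop => hxξ <| by
    rw [htop, ENNReal.mul_top (ENNReal.ofReal_pos.2
      (mul_pos (bracketPow_pos _ _) (bracketPow_pos _ _))).ne']
  have hint := integrable_pairWeight_mul_pairSTFT B u v γ₀ γ₁ hfinite
  refine ⟨_, isDistribProduct_superposition B u v hh₀ hh₁ hint, ?_⟩
  refine (mixedNorm_le_mul (c := ENNReal.ofReal K * ‖B‖ₑ)
    (ENNReal.mul_ne_top ENNReal.ofReal_ne_top enorm_ne_top) fun y η => ?_).trans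
    ((mul_le_mul_right (hC u v) _).trans_eq (by ring))
  unfold weightedSTFT
  rw [mul_left_comm]
  gcongr
  exact hK B u v γ₀ γ₁ hint y η

end ProductEstimate

section WindowNorms

variable {d : ℕ} {E : Type*} [NormedAddCommGroup E] [NormedSpace ℂ E]

theorem conjSchwartz_ne_zero {g : 𝓢(Rd d, ℂ)} (hg : g ≠ 0) : conjSchwartz g ≠ 0 := by
  contrapose! hg
  ext y
  simpa [conjSchwartz_apply] using DFunLike.congr_fun hg y

theorem fourierInv_schwartz_ne_zero {g : 𝓢(Rd d, ℂ)} (hg : g ≠ 0) : 𝓕⁻ g ≠ 0 := by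
  contrapose! hg
  have hinv : 𝓕 (𝓕⁻ g) = g := FourierTransform.fourier_fourierInv_eq g
  rw [← hinv, hg]
  exact map_zero (fourierCLM ℂ 𝓢(Rd d, ℂ))

theorem ofReal_mul_eLpNorm_mul_norm {X F : Type*} [MeasurableSpace X] [NormedAddCommGroup F]
    (ν : Measure X) {a : ℝ} (ha : 0 ≤ a) {b : X → ℝ} (hb : ∀ x, 0 ≤ b x) (f : X → F) (p : ℝ≥0∞) :
    ENNReal.ofReal a * eLpNorm (fun x => b x * ‖f x‖) p ν
      = eLpNorm (fun x => ENNReal.ofReal (b x * a) * ‖f x‖ₑ) p ν := by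
  rw [← Real.enorm_of_nonneg ha, ← eLpNorm_const_smul]
  refine eLpNorm_congr_enorm_ae (Eventually.of_forall fun x => ?_)
  rw [enorm_eq_self, Pi.smul_apply, smul_eq_mul, mul_left_comm, ← mul_assoc, enorm_mul, enorm_norm,
    Real.enorm_of_nonneg (mul_nonneg (hb x) ha)]

theorem modulationNorm_eq_mixedNorm (p q : ℝ≥0∞) (r s : ℝ) (g : 𝓢(Rd d, ℂ)) (u : 𝓢'(Rd d, E)) :
    modulationNorm p q r s g u = mixedNorm p q (weightedSTFT r s (conjSchwartz g) u) := by
  unfold modulationNorm mixedNorm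
  congr 1 with ξ
  exact ofReal_mul_eLpNorm_mul_norm _ (bracketPow_nonneg s ξ) (bracketPow_nonneg r) _ p

theorem enorm_stft_fourierInv (g : 𝓢(Rd d, ℂ)) (v : 𝓢'(Rd d, E)) (x ξ : Rd d) :
    ‖stft g (𝓕⁻ v) x ξ‖ₑ = ‖clmSTFT (𝓕⁻ (conjSchwartz g)) v (ξ, -x)‖ₑ := by
  have e : stft g (𝓕⁻ v) x ξ = v (𝓕⁻ (tfShift (conjSchwartz g) x ξ)) :=
    TemperedDistribution.fourierInv_apply v _
  rw [e, fourierInv_tfShift, map_smul, enorm_smul, ← ofReal_norm (negCharacter ξ x),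
    norm_negCharacter, ENNReal.ofReal_one, one_mul]
  rfl

theorem amalgamNorm_fourierInv_eq_mixedNorm (p q : ℝ≥0∞) (r s : ℝ) (g : 𝓢(Rd d, ℂ))
    (v : 𝓢'(Rd d, E)) :
    amalgamNorm p q r s g (𝓕⁻ v)
      = mixedNorm p q (weightedSTFT r s (𝓕⁻ (conjSchwartz g)) v) := by
  have hF := continuous_weightedSTFT r s (𝓕⁻ (conjSchwartz g)) (v : 𝓢(Rd d, ℂ) →L[ℂ] E)
  have hn := measurable_eLpNorm_of_continuous (μ := volume) hF p
  have hreflect := eLpNorm_comp_measurePreserving (p := q) hn.aestronglyMeasurable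
    (Measure.measurePreserving_neg (volume : Measure (Rd d)))
  rw [mixedNorm, ← hreflect, amalgamNorm]
  congr 1 with x
  rw [ofReal_mul_eLpNorm_mul_norm _ (bracketPow_nonneg s x) (bracketPow_nonneg r)]
  simp only [Function.comp_apply, weightedSTFT, bracketPow_neg_arg, enorm_stft_fourierInv]

theorem amalgamNorm_eq_mixedNorm_fourier (p q : ℝ≥0∞) (r s : ℝ) (g : 𝓢(Rd d, ℂ))
    (f : 𝓢'(Rd d, E)) :
    amalgamNorm p q r s g f
      = mixedNorm p q (weightedSTFT r s (𝓕⁻ (conjSchwartz g)) (𝓕 f : 𝓢'(Rd d, E))) := by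
  have hinv : 𝓕⁻ (𝓕 f) = f := FourierTransform.fourierInv_fourier_eq f
  rw [← amalgamNorm_fourierInv_eq_mixedNorm, hinv]

theorem MemModulation.modulationNorm_ne_top {p q : ℝ≥0∞} (hp : 1 ≤ p) (hq : 1 ≤ q) {r s : ℝ}
    {u : 𝓢'(Rd d, E)} (hu : MemModulation p q r s u) (g : 𝓢(Rd d, ℂ)) :
    modulationNorm p q r s g u ≠ ∞ := by
  obtain ⟨g', hg', hfin⟩ := hu
  obtain ⟨C, hC, hle⟩ := exists_mixedNorm_weightedSTFT_le (E := E) (conjSchwartz_ne_zero hg')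
    (conjSchwartz g) hp hq r s
  rw [modulationNorm_eq_mixedNorm] at hfin ⊢
  exact ne_top_of_le_ne_top (ENNReal.mul_ne_top hC hfin.ne) (hle u)

theorem MemAmalgam.amalgamNorm_ne_top {p q : ℝ≥0∞} (hp : 1 ≤ p) (hq : 1 ≤ q) {r s : ℝ}
    {f : 𝓢'(Rd d, E)} (hf : MemAmalgam p q r s f) (g : 𝓢(Rd d, ℂ)) :
    amalgamNorm p q r s g f ≠ ∞ := by
  obtain ⟨g', hg', hfin⟩ := hf
  obtain ⟨C, hC, hle⟩ := exists_mixedNorm_weightedSTFT_le (E := E)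
    (fourierInv_schwartz_ne_zero (conjSchwartz_ne_zero hg')) (𝓕⁻ (conjSchwartz g)) hp hq r s
  rw [amalgamNorm_eq_mixedNorm_fourier] at hfin ⊢
  exact ne_top_of_le_ne_top (ENNReal.mul_ne_top hC hfin.ne) (hle (𝓕 f))

end WindowNorms

theorem mainTheorem11_general {d : ℕ} {E₀ E₁ E₂ : Type*}
    [NormedAddCommGroup E₀] [NormedSpace ℂ E₀] [NormedAddCommGroup E₁] [NormedSpace ℂ E₁]
    [NormedAddCommGroup E₂] [NormedSpace ℂ E₂] [CompleteSpace E₂]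
    {p q : ℝ≥0∞} (hp : 1 ≤ p) (hq : 1 ≤ q) (r s δ : ℝ)
    {g₀ g₁ g₂ : 𝓢(Rd d, ℂ)} (hg₀ : g₀ ≠ 0) (hg₁ : g₁ ≠ 0) (hg₂ : g₂ ≠ 0) :
    ∃ C : ℝ, 0 < C ∧ ∀ (B : E₀ →L[ℂ] E₁ →L[ℂ] E₂) (μ : 𝓢'(Rd d, E₀)),
      MemModulation ∞ 1 δ |s| μ → ∀ f : 𝓢'(Rd d, E₁), MemAmalgam p q r s f →
        ∃ hf : f ∈ (fourierMultiplier B μ).domain,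
          MemAmalgam p q (r + δ) s (fourierMultiplier B μ ⟨f, hf⟩) ∧
          amalgamNorm p q (r + δ) s g₂ (fourierMultiplier B μ ⟨f, hf⟩) ≤
            ENNReal.ofReal C * ‖B‖ₑ * modulationNorm ∞ 1 δ |s| g₀ μ *
              amalgamNorm p q r s g₁ f := by
  obtain ⟨C, hC, hproduct⟩ := exists_isDistribProduct_mixedNorm_le (E₀ := E₀) (E₁ := E₁)
    (E₂ := E₂) hp hq r s δ (conjSchwartz_ne_zero hg₀)
    (fourierInv_schwartz_ne_zero (conjSchwartz_ne_zero hg₁)) (𝓕⁻ (conjSchwartz g₂))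
  have hC_le : C ≤ ENNReal.ofReal (C.toReal + 1) :=
    (ENNReal.le_ofReal_iff_toReal_le hC (by positivity)).2 (by linarith)
  refine ⟨C.toReal + 1, by positivity, fun B μ hμ f hf => ?_⟩
  have hμ_fin := hμ.modulationNorm_ne_top le_top le_rfl g₀
  have hf_fin := hf.amalgamNorm_ne_top hp hq g₁
  rw [modulationNorm_eq_mixedNorm] at hμ_fin ⊢
  rw [amalgamNorm_eq_mixedNorm_fourier] at hf_fin ⊢
  obtain ⟨w, hw, hnorm⟩ := hproduct B μ (𝓕 f) hμ_fin hf_fin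
  have hfin := ENNReal.mul_ne_top
    (ENNReal.mul_ne_top (ENNReal.mul_ne_top hC (enorm_ne_top (x := B))) hμ_fin) hf_fin
  refine ⟨⟨w, hw⟩, ?_⟩
  rw [fourierMultiplier_eq hw]
  rw [← amalgamNorm_fourierInv_eq_mixedNorm] at hnorm
  exact ⟨⟨g₂, hg₂, hnorm.trans_lt hfin.lt_top⟩, hnorm.trans (by gcongr)⟩

theorem mainTheorem11 {d : ℕ} {E₀ E₁ E₂ : Type*}
    [NormedAddCommGroup E₀] [NormedSpace ℂ E₀] [CompleteSpace E₀]
    [NormedAddCommGroup E₁] [NormedSpace ℂ E₁] [CompleteSpace E₁]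
    [NormedAddCommGroup E₂] [NormedSpace ℂ E₂] [CompleteSpace E₂]
    (B : E₀ →L[ℂ] E₁ →L[ℂ] E₂) (hB : ‖B‖ ≤ 1)
    (p q : ℝ≥0∞) (hp : 1 ≤ p) (hq : 1 ≤ q) (r s δ : ℝ)
    (g₀ g₁ g₂ : 𝓢(Rd d, ℂ)) (hg₀ : g₀ ≠ 0) (hg₁ : g₁ ≠ 0) (hg₂ : g₂ ≠ 0) :
    ∃ C : ℝ, 0 < C ∧
      ∀ μ : 𝓢'(Rd d, E₀), MemModulation ∞ 1 δ |s| μ →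
      ∀ f : 𝓢'(Rd d, E₁), MemAmalgam p q r s f →
        ∃ hf : f ∈ (fourierMultiplier B μ).domain,
          MemAmalgam p q (r + δ) s (fourierMultiplier B μ ⟨f, hf⟩) ∧
          amalgamNorm p q (r + δ) s g₂ (fourierMultiplier B μ ⟨f, hf⟩) ≤
            ENNReal.ofReal C * modulationNorm ∞ 1 δ |s| g₀ μ * amalgamNorm p q r s g₁ f := by
  obtain ⟨C, hC, hbound⟩ := mainTheorem11_general (E₀ := E₀) (E₁ := E₁) (E₂ := E₂)
    hp hq r s δ hg₀ hg₁ hg₂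
  refine ⟨C, hC, fun μ hμ f hf => ?_⟩
  obtain ⟨hdom, hmem, hle⟩ := hbound B μ hμ f hf
  refine ⟨hdom, hmem, hle.trans ?_⟩
  gcongr
  exact mul_le_of_le_one_right' (enorm_le_coe.2 hB : ‖B‖ₑ ≤ (1 : NNReal))
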